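/- Let $(M,g)$ be a closed (compact, without boundary), oriented, smooth $n$-dimensional Riemannian manifold with Levi-Civita connection $\nabla$ and canonical volume form $\mu$. Let $\mathfrak X(M)$ be the Lie algebra of smooth vector fields with the usual Lie bracket, and put $\operatorname{ad}(X)Y=[X,Y]$. For $Y\in\mathfrak X(M)$ let $\flat Y=g(Y,\cdot)$, let $\operatorname{div}Y$ be the function with $L_Y\mu=(\operatorname{div}Y)\,\mu$, and for a $1$-form $\varphi$ put $(\nabla\varphi)^{\mathrm{sym}}(X,Z)=(\nabla_X\varphi)(Z)+(\nabla_Z\varphi)(X)$. A vector field is called Killing if it generates a flow of isometries of $(M,g)$. (1) Let $\mathfrak g\subseteq\mathfrak X(M)$ be a Lie subalgebra (for example a closed one) such that for every $X\in\mathfrak g$ the adjoint $\operatorname{ad}(X)^{\top}:\mathfrak g\to\mathfrak g$ of $\operatorname{ad}(X)$ with respect to the $L^2$ scalar product $\langle Z,W\rangle=\int_M g(Z,W)\,\mu$ exists, i.e. a linear map with $\langle\operatorname{ad}(X)^{\top}Z,W\rangle=\langle Z,[X,W]\rangle$ for all $Z,W\in\mathfrak g$. Then for all $X,Y\in\mathfrak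 g$ $$2\int_M g(\operatorname{ad}(X)^{\top}X,Y)\,\mu=\int_M\big((\nabla\flat Y)^{\mathrm{sym}}+(\operatorname{div}Y)\,g\big)(X,X)\,\mu .$$ (2) For every $Y\in\mathfrak X(M)$, the trace with respect to $g$ satisfies $$\operatorname{tr}\big((\nabla\flat Y)^{\mathrm{sym}}+(\operatorname{div}Y)\,g\big)=(n+2)\operatorname{div}Y .$$ (3) For every $Y\in\mathfrak X(M)$, the tensor field $(\nabla\flat Y)^{\mathrm{sym}}+(\operatorname{div}Y)\,g$ vanishes if and only if $(\nabla\flat Y)^{\mathrm{sym}}=0$, and it vanishes if and only if $Y$ is a Killing vector field. -/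

import Mathlib

open Bundle Manifold VectorField MeasureTheory
open scoped ContDiff Topology

noncomputable section

namespace RiemGeom

section LeviCivita

variable {E : Type*} [NormedAddCommGroup E] [NormedSpace ℝ E]
  {H : Type*} [TopologicalSpace H] {I : ModelWithCorners ℝ E H}
  {M : Type*} [TopologicalSpace M] [ChartedSpace H M]
  [RiemannianBundle (fun x : M => TangentSpace I x)]

variable (I) in
/-- The Riemannian metric `g` as a field of bilinear forms. -/
def metricTensor (x : M) : TangentSpace I x →L[ℝ] TangentSpace I x →L[ℝ] ℝ :=
  (RiemannianBundle.g (E := fun x : M => TangentSpace I x)).inner x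

theorem metricTensor_apply (x : M) (v w : TangentSpace I x) :
    metricTensor I x v w = inner ℝ v w := rfl

variable (I) in
/-- The right hand side of the Koszul formula for `2 g(∇_X Y, Z)`:
`X g(Y,Z) + Y g(Z,X) - Z g(X,Y) + g([X,Y],Z) - g([X,Z],Y) - g([Y,Z],X)`. -/
def koszul (Y X Z : ∀ x : M, TangentSpace I x) (x : M) : ℝ :=
  mvfderiv I (fun p => inner ℝ (Y p) (Z p)) x (X x)
  + mvfderiv I (fun p => inner ℝ (Z p) (X p)) x (Y x)
  - mvfderiv I (fun p => inner ℝ (X p) (Y p)) x (Z x)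
  + inner ℝ (mlieBracket I X Y x) (Z x)
  - inner ℝ (mlieBracket I X Z x) (Y x)
  - inner ℝ (mlieBracket I Y Z x) (X x)

variable [IsManifold I ∞ M] [IsContMDiffRiemannianBundle I ∞ E (fun x : M => TangentSpace I x)]

theorem mdiffAt_inner {x : M} {Y Z : ∀ x : M, TangentSpace I x}
    (hY : MDiffAt (T% Y) x) (hZ : MDiffAt (T% Z) x) :
    MDiffAt (fun p => inner ℝ (Y p) (Z p)) x :=
  MDifferentiableAt.inner_bundle (IB := I) (F := E) (E := fun x : M => TangentSpace I x) hY hZ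

variable [FiniteDimensional ℝ E]

theorem koszul_tensorial_left {x : M} {Y Z : ∀ x : M, TangentSpace I x}
    (hY : MDiffAt (T% Y) x) (hZ : MDiffAt (T% Z) x) :
    TensorialAt I E (fun X => koszul I Y X Z x) x where
  smul {f X} hf hX := by
    have : CompleteSpace E := FiniteDimensional.complete ℝ E
    have : IsManifold I (minSmoothness ℝ 2) M := by simp; infer_instance
    have h1 := mvfderiv_fun_mul hf (mdiffAt_inner hZ hX)
    have h2 := mvfderiv_fun_mul hf (mdiffAt_inner hX hY)
    simp [koszul, mlieBracket_smul_left hf hX, inner_add_left, inner_smul_left, inner_smul_right,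
      h1, h2]
    rw [real_inner_comm (X x) (Z x)]
    ring
  add {X X'} hX hX' := by
    have : CompleteSpace E := FiniteDimensional.complete ℝ E
    have : IsManifold I (minSmoothness ℝ 2) M := by simp; infer_instance
    have h1 := mvfderiv_fun_add (mdiffAt_inner hZ hX) (mdiffAt_inner hZ hX')
    have h2 := mvfderiv_fun_add (mdiffAt_inner hX hY) (mdiffAt_inner hX' hY)
    simp [koszul, mlieBracket_add_left hX hX', inner_add_left, inner_add_right, h1, h2]
    ring

theorem koszul_tensorial_right {x : M} {Y X : ∀ x : M, TangentSpace I x}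
    (hY : MDiffAt (T% Y) x) (hX : MDiffAt (T% X) x) :
    TensorialAt I E (fun Z => koszul I Y X Z x) x where
  smul {f Z} hf hZ := by
    have : CompleteSpace E := FiniteDimensional.complete ℝ E
    have : IsManifold I (minSmoothness ℝ 2) M := by simp; infer_instance
    have h1 := mvfderiv_fun_mul hf (mdiffAt_inner hZ hX)
    have h2 := mvfderiv_fun_mul hf (mdiffAt_inner hY hZ)
    simp [koszul, mlieBracket_smul_right hf hZ, inner_add_left, inner_smul_left, inner_smul_right,
      h1, h2]
    rw [real_inner_comm (Z x) (Y x)]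
    ring
  add {Z Z'} hZ hZ' := by
    have : CompleteSpace E := FiniteDimensional.complete ℝ E
    have : IsManifold I (minSmoothness ℝ 2) M := by simp; infer_instance
    have h1 := mvfderiv_fun_add (mdiffAt_inner hZ hX) (mdiffAt_inner hZ' hX)
    have h2 := mvfderiv_fun_add (mdiffAt_inner hY hZ) (mdiffAt_inner hY hZ')
    simp [koszul, mlieBracket_add_right hZ hZ', inner_add_left, inner_add_right, h1, h2]
    ring

variable (I) in
open Classical in
/-- The bilinear form `(X, Z) ↦ 2 g(∇_X Y, Z)` at `x`, given by the Koszul formula (and `0` if `Y` is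
not differentiable at `x`). -/
def koszulTensor (Y : ∀ x : M, TangentSpace I x) (x : M) :
    TangentSpace I x →L[ℝ] TangentSpace I x →L[ℝ] ℝ :=
  if hY : MDiffAt (T% Y) x then
    TensorialAt.mkHom₂ (fun X Z => koszul I Y X Z x) x
      (fun _ hZ => koszul_tensorial_left hY hZ) (fun _ hX => koszul_tensorial_right hY hX)
  else 0

instance instFiniteDimensionalTangent (x : M) : FiniteDimensional ℝ (TangentSpace I x) :=
  inferInstanceAs (FiniteDimensional ℝ E)

instance instCompleteTangent (x : M) : CompleteSpace (TangentSpace I x) :=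
  FiniteDimensional.complete ℝ _

theorem koszulTensor_apply {x : M} {Y X Z : ∀ x : M, TangentSpace I x}
    (hY : MDiffAt (T% Y) x) (hX : MDiffAt (T% X) x) (hZ : MDiffAt (T% Z) x) :
    koszulTensor I Y x (X x) (Z x) = koszul I Y X Z x := by
  rw [koszulTensor, dif_pos hY, TensorialAt.mkHom₂_apply _ _ hX hZ]

variable (I) in
/-- The Levi-Civita covariant derivative as a function: `nabla I Y x v` is `∇_v Y` at `x`. -/
def nabla (Y : ∀ x : M, TangentSpace I x) (x : M) : TangentSpace I x →L[ℝ] TangentSpace I x :=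
  (1 / 2 : ℝ) • InnerProductSpace.continuousLinearMapOfBilin (𝕜 := ℝ) (koszulTensor I Y x)

theorem inner_nabla {x : M} {Y X Z : ∀ x : M, TangentSpace I x}
    (hY : MDiffAt (T% Y) x) (hX : MDiffAt (T% X) x) (hZ : MDiffAt (T% Z) x) :
    inner ℝ (nabla I Y x (X x)) (Z x) = (1 / 2) * koszul I Y X Z x := by
  rw [← koszulTensor_apply hY hX hZ]
  simp [nabla, inner_smul_left]

theorem nabla_eq {x : M} {Y : ∀ x : M, TangentSpace I x} (hY : MDiffAt (T% Y) x)
    {A : TangentSpace I x →L[ℝ] TangentSpace I x}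
    (h : ∀ X Z : ∀ x : M, TangentSpace I x, MDiffAt (T% X) x → MDiffAt (T% Z) x →
      inner ℝ (A (X x)) (Z x) = (1 / 2) * koszul I Y X Z x) : nabla I Y x = A := by
  ext v
  refine ext_inner_right ℝ fun w => ?_
  have hv : MDiffAt (T% (FiberBundle.extend E v)) x := FiberBundle.mdifferentiableAt_extend ..
  have hw : MDiffAt (T% (FiberBundle.extend E w)) x := FiberBundle.mdifferentiableAt_extend ..
  have h1 := inner_nabla hY hv hw
  have h2 := h _ _ hv hw
  simp only [FiberBundle.extend_apply_self] at h1 h2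
  rw [h1, h2]

variable (I M) in
/-- The Levi-Civita connection of the Riemannian manifold `M`; it is torsion-free and metric by the
two theorems below. -/
def leviCivita : CovariantDerivative I E (TangentSpace I : M → Type _) where
  toFun := nabla I
  isCovariantDerivativeOnUniv :=
    { add := by
        intro Y Y' x hY hY' _
        have : CompleteSpace E := FiniteDimensional.complete ℝ E
        have : IsManifold I (minSmoothness ℝ 2) M := by simp; infer_instance
        refine nabla_eq (mdifferentiableAt_add_section hY hY') fun X Z hX hZ => ?_
        have h1 := mvfderiv_fun_add (mdiffAt_inner hY hZ) (mdiffAt_inner hY' hZ)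
        have h2 := mvfderiv_fun_add (mdiffAt_inner hX hY) (mdiffAt_inner hX hY')
        simp [inner_add_left, inner_add_right, inner_nabla hY hX hZ, inner_nabla hY' hX hZ,
          koszul, mlieBracket_add_left hY hY', mlieBracket_add_right hY hY', h1, h2]
        ring
      leibniz := by
        intro Y f x hY hf _
        have : CompleteSpace E := FiniteDimensional.complete ℝ E
        have : IsManifold I (minSmoothness ℝ 2) M := by simp; infer_instance
        refine nabla_eq (hf.smul_section hY) fun X Z hX hZ => ?_
        have h1 := mvfderiv_fun_mul hf (mdiffAt_inner hY hZ)
        have h2 := mvfderiv_fun_mul hf (mdiffAt_inner hX hY)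
        simp [inner_add_left, inner_smul_left, inner_smul_right, inner_nabla hY hX hZ, koszul,
          mlieBracket_smul_left hf hY, mlieBracket_smul_right hf hY, h1, h2]
        rw [real_inner_comm (X x) (Y x)]
        ring }

theorem leviCivita_torsion [CompleteSpace E] : (leviCivita I M).torsion = 0 := by
  rw [CovariantDerivative.torsion_eq_zero_iff]
  intro X Y x hX hY
  refine ext_inner_right ℝ fun w => ?_
  have hw : MDiffAt (T% (FiberBundle.extend E w)) x := FiberBundle.mdifferentiableAt_extend ..
  have h1 := inner_nabla hY hX hw
  have h2 := inner_nabla hX hY hw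
  simp only [FiberBundle.extend_apply_self] at h1 h2
  rw [inner_sub_left]
  change inner ℝ (nabla I Y x (X x)) w - inner ℝ (nabla I X x (Y x)) w = _
  rw [h1, h2]
  simp only [koszul, real_inner_comm, mlieBracket_swap_apply (V := Y) (W := X), inner_neg_left,
    FiberBundle.extend_apply_self]
  ring

theorem leviCivita_inner {x : M} {X Y Z : ∀ x : M, TangentSpace I x}
    (hX : MDiffAt (T% X) x) (hY : MDiffAt (T% Y) x) (hZ : MDiffAt (T% Z) x) :
    mvfderiv I (fun p => inner ℝ (Y p) (Z p)) x (X x) =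
      inner ℝ (leviCivita I M Y x (X x)) (Z x) + inner ℝ (Y x) (leviCivita I M Z x (X x)) := by
  have h1 := inner_nabla hY hX hZ
  have h2 := inner_nabla hZ hX hY
  change _ = inner ℝ (nabla I Y x (X x)) (Z x) + inner ℝ (Y x) (nabla I Z x (X x))
  rw [real_inner_comm _ (Y x), h1, h2]
  simp only [koszul, real_inner_comm, mlieBracket_swap_apply (V := Z) (W := Y), inner_neg_left]
  ring

variable (I) in
/-- The one-form `φ` is differentiable at `x`, as a section of the cotangent bundle. -/
def OneFormDiffAt (φ : ∀ x : M, TangentSpace I x →L[ℝ] ℝ) (x : M) : Prop :=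
  MDifferentiableAt I (I.prod 𝓘(ℝ, E →L[ℝ] ℝ))
    (fun p => TotalSpace.mk' (E →L[ℝ] ℝ)
      (E := fun p : M => TangentSpace I p →L[ℝ] Bundle.Trivial M ℝ p) p (φ p)) x

theorem nablaForm_tensorial {φ : ∀ x : M, TangentSpace I x →L[ℝ] ℝ} {x : M}
    (hφ : OneFormDiffAt I φ x) :
    TensorialAt I E (fun Z : ∀ x : M, TangentSpace I x =>
      mvfderiv I (fun p => φ p (Z p)) x - (φ x) ∘L (leviCivita I M Z x)) x := by
  have key : ∀ {Z : ∀ x : M, TangentSpace I x}, MDiffAt (T% Z) x →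
      MDiffAt (fun p => φ p (Z p)) x := by
    intro Z hZ
    have := MDifferentiableAt.clm_bundle_apply (F₁ := E) (F₂ := ℝ) (E₂ := Bundle.Trivial M ℝ)
      (b := fun p : M => p) hφ hZ
    rw [mdifferentiableAt_totalSpace] at this
    exact this.2
  constructor
  · intro f Z hf hZ
    have h1 := mvfderiv_fun_mul hf (key hZ)
    have h2 := (leviCivita I M).isCovariantDerivativeOnUniv.leibniz hZ hf
    ext v
    simp [h1, h2]
    ring
  · intro Z Z' hZ hZ'
    have h1 := mvfderiv_fun_add (key hZ) (key hZ')
    have h2 := (leviCivita I M).isCovariantDerivativeOnUniv.add hZ hZ'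
    ext v
    simp [h1, h2]
    ring

variable (I) in
open Classical in
/-- The covariant derivative of a one-form, as a bilinear form at `x`:
`nablaForm I φ x X Z = (∇_X φ)(Z) = X(φ(Z)) - φ(∇_X Z)` (and `0` if `φ` is not differentiable at
`x`). -/
def nablaForm (φ : ∀ x : M, TangentSpace I x →L[ℝ] ℝ) (x : M) :
    TangentSpace I x →L[ℝ] TangentSpace I x →L[ℝ] ℝ :=
  if hφ : OneFormDiffAt I φ x then
    (TensorialAt.mkHom _ x (nablaForm_tensorial hφ)).flip
  else 0

variable (I) in
/-- The one-form `♭Y = g(Y, ·)`. -/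
def flat (Y : ∀ x : M, TangentSpace I x) (x : M) : TangentSpace I x →L[ℝ] ℝ :=
  metricTensor I x (Y x)

variable (I) in
/-- `(∇φ)^sym(X, Z) = (∇_X φ)(Z) + (∇_Z φ)(X)` (without a factor `1/2`). -/
def nablaFormSym (φ : ∀ x : M, TangentSpace I x →L[ℝ] ℝ) (x : M) :
    TangentSpace I x →L[ℝ] TangentSpace I x →L[ℝ] ℝ :=
  nablaForm I φ x + (nablaForm I φ x).flip

variable (I) in
/-- An isometry of the Riemannian manifold: a diffeomorphism that preserves the metric. -/
def IsRiemannianIsometry (f : M → M) : Prop :=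
  (∃ e : Diffeomorph I I M M ∞, ⇑e = f) ∧
    ∀ (x : M) (v w : TangentSpace I x),
      metricTensor I (f x) (mfderiv I I f x v) (mfderiv I I f x w) = metricTensor I x v w

variable (I) in
/-- `Y` is a Killing vector field: it generates a flow of isometries. -/
def IsKilling (Y : ∀ x : M, TangentSpace I x) : Prop :=
  ∃ Φ : ℝ → M → M, (∀ x, Φ 0 x = x) ∧ (∀ x, IsMIntegralCurve (I := I) (fun t => Φ t x) Y) ∧
    ∀ t, IsRiemannianIsometry I (Φ t)

end LeviCivita

section VectorFields

variable {n : ℕ} {M : Type*} [TopologicalSpace M] [ChartedSpace (EuclideanSpace ℝ (Fin n)) M]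
  [IsManifold (𝓡 n) ∞ M]

variable (n M) in
/-- `𝔛(M)`: the smooth vector fields on the `n`-dimensional manifold `M`. -/
abbrev VField : Type _ :=
  ContMDiffSection (𝓡 n) (EuclideanSpace ℝ (Fin n)) ∞ (fun x : M => TangentSpace (𝓡 n) x)

/-- The usual Lie bracket of smooth vector fields. -/
instance instBracketVField : Bracket (VField n M) (VField n M) where
  bracket X Y := ⟨mlieBracket (𝓡 n) X Y, by
    have : IsManifold (𝓡 n) (((⊤ : ℕ∞) : WithTop ℕ∞) + 1) M := by
      simpa using (inferInstance : IsManifold (𝓡 n) ∞ M)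
    have : IsManifold (𝓡 n) (minSmoothness ℝ 2) M := by simp; infer_instance
    have : IsManifold (𝓡 n) (minSmoothness ℝ 3) M := by simp; infer_instance
    exact ContDiff.mlieBracket_vectorField (I := 𝓡 n) (m := ⊤) (n := ⊤)
      X.contMDiff Y.contMDiff (by simp)⟩

theorem bracket_coe (X Y : VField n M) :
    (⇑⁅X, Y⁆ : ∀ x : M, TangentSpace (𝓡 n) x) = mlieBracket (𝓡 n) X Y := rfl

instance instLieRingVField : LieRing (VField n M) where
  add_lie X Y Z := by
    have : IsManifold (𝓡 n) (minSmoothness ℝ 2) M := by simp; infer_instance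
    ext1 x
    exact mlieBracket_add_left X.mdifferentiableAt Y.mdifferentiableAt
  lie_add X Y Z := by
    have : IsManifold (𝓡 n) (minSmoothness ℝ 2) M := by simp; infer_instance
    ext1 x
    exact mlieBracket_add_right Y.mdifferentiableAt Z.mdifferentiableAt
  lie_self X := by
    ext1 x
    simp [bracket_coe]
  leibniz_lie X Y Z := by
    ext1 x
    have : IsManifold (𝓡 n) (minSmoothness ℝ 3) M := by simp; infer_instance
    have h2 : (minSmoothness ℝ 2 : WithTop ℕ∞) ≤ ∞ := by
      simpa using (ENat.LEInfty.out : (2 : WithTop ℕ∞) ≤ ∞)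
    exact leibniz_identity_mlieBracket_apply (X.contMDiff.of_le h2 x) (Y.contMDiff.of_le h2 x)
      (Z.contMDiff.of_le h2 x)

instance instLieAlgebraVField : LieAlgebra ℝ (VField n M) where
  lie_smul c X Y := by
    have : IsManifold (𝓡 n) (minSmoothness ℝ 2) M := by simp; infer_instance
    ext1 x
    exact mlieBracket_const_smul_right Y.mdifferentiableAt

end VectorFields

section Integration

variable {n : ℕ} {M : Type*} [TopologicalSpace M] [ChartedSpace (EuclideanSpace ℝ (Fin n)) M]

variable (n M) in
/-- An orientation of the manifold `M`: an orientation of each tangent space, locally constant in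
local trivializations of the tangent bundle. -/
structure ManifoldOrientation [IsManifold (𝓡 n) 1 M] where
  /-- The orientation of the tangent space at `x`. -/
  orient (x : M) : Orientation ℝ (TangentSpace (𝓡 n) x) (Fin n)
  locallyConstant (c : M) : ∃ o₀ : Orientation ℝ (EuclideanSpace ℝ (Fin n)) (Fin n),
    ∀ᶠ x in 𝓝 c, ∀ hx : x ∈ (trivializationAt (EuclideanSpace ℝ (Fin n))
        (TangentSpace (𝓡 n) : M → Type _) c).baseSet,
      Orientation.map (Fin n) ((trivializationAt (EuclideanSpace ℝ (Fin n))
        (TangentSpace (𝓡 n) : M → Type _) c).continuousLinearEquivAt ℝ x hx).toLinearEquiv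
        (orient x) = o₀

theorem finrank_tangent (x : M) : Module.finrank ℝ (TangentSpace (𝓡 n) x) = n :=
  finrank_euclideanSpace_fin (𝕜 := ℝ)

instance instFactFinrankTangent (x : M) : Fact (Module.finrank ℝ (TangentSpace (𝓡 n) x) = n) :=
  ⟨finrank_tangent x⟩

variable [RiemannianBundle (fun x : M => TangentSpace (𝓡 n) x)] [IsManifold (𝓡 n) ∞ M]

/-- The canonical volume form `μ` of the oriented Riemannian manifold `M`. -/
def volForm (o : ManifoldOrientation n M) (x : M) : TangentSpace (𝓡 n) x [⋀^Fin n]→ₗ[ℝ] ℝ :=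
  (o.orient x).volumeForm

/-- An orthonormal basis of the tangent space at `x`. -/
def orthoFrame (x : M) : OrthonormalBasis (Fin n) ℝ (TangentSpace (𝓡 n) x) :=
  (stdOrthonormalBasis ℝ (TangentSpace (𝓡 n) x)).reindex (finCongr (finrank_tangent x))

/-- The trace `∑ i, T(e_i, e_i)` of a bilinear form with respect to the metric. -/
def metricTrace {x : M} (T : TangentSpace (𝓡 n) x →L[ℝ] TangentSpace (𝓡 n) x →L[ℝ] ℝ) : ℝ :=
  ∑ i, T (orthoFrame x i) (orthoFrame x i)

/-- The Lie derivative `(L_Y μ)(v₁, …, vₙ) = Y(μ(V₁, …, Vₙ)) - ∑ i, μ(v₁, …, [Y, V_i], …, vₙ)` of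
the volume form at `x`, where `V_i` is a vector field that is smooth near `x` with value `v_i`
at `x`. -/
def lieDerivVol (o : ManifoldOrientation n M) (Y : ∀ x : M, TangentSpace (𝓡 n) x) (x : M)
    (v : Fin n → TangentSpace (𝓡 n) x) : ℝ :=
  let V : Fin n → ∀ p : M, TangentSpace (𝓡 n) p :=
    fun i => FiberBundle.extend (EuclideanSpace ℝ (Fin n)) (v i)
  mvfderiv (𝓡 n) (fun p => volForm o p (fun i => V i p)) x (Y x)
    - ∑ i, volForm o x (Function.update v i (mlieBracket (𝓡 n) Y (V i) x))

/-- The divergence of `Y`, i.e. the function with `L_Y μ = (div Y) μ`, computed by evaluating both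
sides on a basis of the tangent space. -/
def divergence (o : ManifoldOrientation n M) (Y : ∀ x : M, TangentSpace (𝓡 n) x) (x : M) : ℝ :=
  lieDerivVol o Y x (orthoFrame x) / volForm o x (orthoFrame x)

variable (n M) in
/-- A smooth partition of unity on `M` subordinate to the cover by chart domains. -/
def chartPartition [CompactSpace M] [T2Space M] :
    SmoothPartitionOfUnity M (𝓡 n) M Set.univ :=
  (SmoothPartitionOfUnity.exists_isSubordinate_chartAt_source (𝓡 n) M).choose

/-- The coordinate frame `∂₁, …, ∂ₙ` of the chart around `c`, at the point with coordinates `y`. -/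
def coordFrame (c : M) (y : EuclideanSpace ℝ (Fin n)) (i : Fin n) :
    TangentSpace (𝓡 n) ((extChartAt (𝓡 n) c).symm y) :=
  mfderiv 𝓘(ℝ, EuclideanSpace ℝ (Fin n)) (𝓡 n) (extChartAt (𝓡 n) c).symm y
    (EuclideanSpace.single i (1 : ℝ))

/-- The integral `∫_M η` of a top-degree form over the closed oriented manifold `M`, by means of a
partition of unity. The sign accounts for charts that do not preserve the orientation. -/
def integralForm [CompactSpace M] [T2Space M] (o : ManifoldOrientation n M)
    (η : ∀ x : M, TangentSpace (𝓡 n) x [⋀^Fin n]→ₗ[ℝ] ℝ) : ℝ :=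
  ∑ᶠ c : M, ∫ y in (extChartAt (𝓡 n) c).target,
    Real.sign (volForm o ((extChartAt (𝓡 n) c).symm y) (coordFrame c y)) *
      (chartPartition n M c ((extChartAt (𝓡 n) c).symm y) *
        η ((extChartAt (𝓡 n) c).symm y) (coordFrame c y))

/-- The integral `∫_M f μ` of a function against the canonical volume form. -/
def integralVol [CompactSpace M] [T2Space M] (o : ManifoldOrientation n M) (f : M → ℝ) : ℝ :=
  integralForm o (fun x => f x • volForm o x)

/-- The `L²` scalar product `∫_M g(X, Y) μ` of vector fields. -/
def l2Inner [CompactSpace M] [T2Space M] (o : ManifoldOrientation n M)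
    (X Y : ∀ x : M, TangentSpace (𝓡 n) x) : ℝ :=
  integralVol o (fun x => metricTensor (𝓡 n) x (X x) (Y x))

/-- `A` is the adjoint of `ad(X) = [X, ·]` on `𝔤` with respect to the `L²` scalar product. -/
def IsAdjointOfAd [CompactSpace M] [T2Space M] (o : ManifoldOrientation n M)
    (𝔤 : LieSubalgebra ℝ (VField n M)) (X : 𝔤) (A : 𝔤 →ₗ[ℝ] 𝔤) : Prop :=
  ∀ Z W : 𝔤, l2Inner o (A Z : VField n M) (W : VField n M) =
    l2Inner o (Z : VField n M) (⁅X, W⁆ : 𝔤).1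

variable [IsContMDiffRiemannianBundle (𝓡 n) ∞ (EuclideanSpace ℝ (Fin n))
    (fun x : M => TangentSpace (𝓡 n) x)]

/-- The symmetric 2-tensor field `(∇♭Y)^sym + (div Y) g`. -/
def symDivTensor (o : ManifoldOrientation n M) (Y : ∀ x : M, TangentSpace (𝓡 n) x) (x : M) :
    TangentSpace (𝓡 n) x →L[ℝ] TangentSpace (𝓡 n) x →L[ℝ] ℝ :=
  nablaFormSym (𝓡 n) (flat (𝓡 n) Y) x + divergence o Y x • metricTensor (𝓡 n) x

end Integration

end RiemGeom

end

/-! Everything rests on one pointwise identity. The connection is torsion-free and metric, so `2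
g(X,[X,Y]) = 2 g(∇_X Y, X) - Y(f)` with `f = g(X,X)`. The first term on the right is
`(∇♭Y)^sym(X,X)`, and `-Y(f) = f div Y - div(f Y)`. Hence the tensor evaluated on `(X,X)` equals `2
g(X,[X,Y]) + div(f Y)`. Integration kills the divergence, and the definition of the adjoint turns
`⟨X,[X,Y]⟩` into `⟨ad(X)^⊤ X, Y⟩`. This is `integralVol_adjoint_eq`.

The divergence is defined by `L_Y μ` and must be identified with `tr ∇Y` (`divergence_eq_trace`). On
a local frame `μ` is a constant sign times the square root of the Gram determinant, so metric
compatibility and Jacobi's formula give its derivative. The same computation in coordinates yields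
`√g div W = ∑ ∂_i(√g W^i)`, from which the divergence theorem `integralVol_divergence` follows by a
partition of unity.

The trace formula is `tr (∇♭Y)^sym = 2 tr ∇Y` together with `tr g = n`. If the tensor vanishes then
`(n+2) div Y = 0`, so `div Y = 0` and `(∇♭Y)^sym = 0`; conversely `(∇♭Y)^sym = 0` has trace `2 div Y
= 0`.

For Killing fields, `d/ds g(dΦ_s v, dΦ_s v) = 2 g(∇_w Y, w)` with `w = dΦ_s v`
(`IsFlow.hasDerivAt_metric`), so the flow is isometric exactly when `g(∇_v Y, v) = 0` for all `v`,
which is `(∇♭Y)^sym = 0` by polarization. The converse needs a global smooth flow. Smooth dependence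
on time and initial point comes from the implicit function theorem on a Banach space of curves, and
compactness makes the flow complete. -/

noncomputable section

namespace RiemGeom

/-! ### Vector fields, derivatives and Lie brackets in a chart. -/

section Coordinates

variable {n : ℕ} {M : Type*} [TopologicalSpace M] [ChartedSpace (EuclideanSpace ℝ (Fin n)) M]
  [IsManifold (𝓡 n) ∞ M]

/-- The vector field `Y` is differentiable at `p`. -/
abbrev VDiffAt (Y : ∀ p : M, TangentSpace (𝓡 n) p) (p : M) : Prop :=
  MDifferentiableAt (𝓡 n) ((𝓡 n).prod 𝓘(ℝ, EuclideanSpace ℝ (Fin n))) (T% Y) p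

/-- The vector field with constant components `u` in the chart around `c`. -/
def coordField (c : M) (u : EuclideanSpace ℝ (Fin n)) (p : M) : TangentSpace (𝓡 n) p :=
  (trivializationAt (EuclideanSpace ℝ (Fin n)) (TangentSpace (𝓡 n) : M → Type _) c).symmL ℝ p u

/-- The components of a tangent vector in the chart around `c`. -/
def coordComp (c p : M) : TangentSpace (𝓡 n) p →L[ℝ] EuclideanSpace ℝ (Fin n) :=
  (trivializationAt (EuclideanSpace ℝ (Fin n)) (TangentSpace (𝓡 n) : M → Type _) c).continuousLinearMapAt ℝ p

/-- The components of a vector field in the chart around `c`, as a function of the coordinates. -/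
def coordRep (c : M) (Y : ∀ p : M, TangentSpace (𝓡 n) p) (y : EuclideanSpace ℝ (Fin n)) :
    EuclideanSpace ℝ (Fin n) :=
  coordComp c ((extChartAt (𝓡 n) c).symm y) (Y ((extChartAt (𝓡 n) c).symm y))

variable {c p : M}

theorem coordComp_coordField (hp : p ∈ (extChartAt (𝓡 n) c).source)
    (u : EuclideanSpace ℝ (Fin n)) : coordComp c p (coordField c u p) = u :=
  Trivialization.continuousLinearMapAt_symmL _ (by simpa using hp) _

theorem coordField_coordComp (hp : p ∈ (extChartAt (𝓡 n) c).source)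
    (v : TangentSpace (𝓡 n) p) : coordField c (coordComp c p v) p = v :=
  Trivialization.symmL_continuousLinearMapAt _ (by simpa using hp) _

theorem coordComp_eq_mfderiv (hp : p ∈ (extChartAt (𝓡 n) c).source) :
    coordComp c p = mfderiv (𝓡 n) 𝓘(ℝ, EuclideanSpace ℝ (Fin n)) (extChartAt (𝓡 n) c) p :=
  TangentBundle.continuousLinearMapAt_trivializationAt (by simpa using hp)

theorem coordField_eq_mfderiv (hp : p ∈ (extChartAt (𝓡 n) c).source)
    (u : EuclideanSpace ℝ (Fin n)) :
    coordField c u p = mfderiv 𝓘(ℝ, EuclideanSpace ℝ (Fin n)) (𝓡 n) (extChartAt (𝓡 n) c).symm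
      (extChartAt (𝓡 n) c p) u := by
  rw [coordField, TangentBundle.symmL_trivializationAt (by simpa using hp)]
  simp only [modelWithCornersSelf_coe, Set.range_id, mfderivWithin_univ]
  rfl

theorem coordField_symm {y : EuclideanSpace ℝ (Fin n)} (hy : y ∈ (extChartAt (𝓡 n) c).target)
    (u : EuclideanSpace ℝ (Fin n)) : coordField c u ((extChartAt (𝓡 n) c).symm y) =
      mfderiv 𝓘(ℝ, EuclideanSpace ℝ (Fin n)) (𝓡 n) (extChartAt (𝓡 n) c).symm y u := by
  rw [coordField_eq_mfderiv ((extChartAt (𝓡 n) c).map_target hy),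
    (extChartAt (𝓡 n) c).right_inv hy]

theorem coordFrame_eq {y : EuclideanSpace ℝ (Fin n)} (hy : y ∈ (extChartAt (𝓡 n) c).target)
    (i : Fin n) : coordFrame c y i =
      coordField c (EuclideanSpace.single i (1 : ℝ)) ((extChartAt (𝓡 n) c).symm y) :=
  (coordField_symm hy _).symm

theorem contMDiffAt_coordField (hp : p ∈ (extChartAt (𝓡 n) c).source)
    (u : EuclideanSpace ℝ (Fin n)) :
    ContMDiffAt (𝓡 n) ((𝓡 n).prod 𝓘(ℝ, EuclideanSpace ℝ (Fin n))) ∞ (T% (coordField c u)) p := by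
  have hb : p ∈ (trivializationAt (EuclideanSpace ℝ (Fin n))
    (TangentSpace (𝓡 n) : M → Type _) c).baseSet := by simpa using hp
  rw [Trivialization.contMDiffAt_section_iff (IB := 𝓡 n)
    (trivializationAt (EuclideanSpace ℝ (Fin n)) (TangentSpace (𝓡 n) : M → Type _) c) hb]
  refine (contMDiffAt_const (c := u)).congr_of_eventuallyEq ?_
  filter_upwards [(trivializationAt (EuclideanSpace ℝ (Fin n))
    (TangentSpace (𝓡 n) : M → Type _) c).open_baseSet.mem_nhds hb] with q hq
  have h := coordComp_coordField (c := c) (p := q) (by simpa using hq) u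
  simp only [coordComp, Trivialization.continuousLinearMapAt_apply] at h
  rwa [Trivialization.linearMapAt_apply, if_pos hq] at h

theorem mdifferentiableAt_coordField (hp : p ∈ (extChartAt (𝓡 n) c).source)
    (u : EuclideanSpace ℝ (Fin n)) : VDiffAt (coordField c u) p :=
  (contMDiffAt_coordField hp u).mdifferentiableAt (by simp)

theorem contMDiffAt_extChartAt_symm_of_mem {y : EuclideanSpace ℝ (Fin n)}
    (hy : y ∈ (extChartAt (𝓡 n) c).target) :
    ContMDiffAt 𝓘(ℝ, EuclideanSpace ℝ (Fin n)) (𝓡 n) ∞ (extChartAt (𝓡 n) c).symm y :=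
  (contMDiffOn_extChartAt_symm c).contMDiffAt ((isOpen_extChartAt_target c).mem_nhds hy)

theorem contDiffAt_coordRep {Y : ∀ p : M, TangentSpace (𝓡 n) p} {y : EuclideanSpace ℝ (Fin n)}
    {k : ℕ∞} (hy : y ∈ (extChartAt (𝓡 n) c).target)
    (hY : ContMDiffAt (𝓡 n) ((𝓡 n).prod 𝓘(ℝ, EuclideanSpace ℝ (Fin n))) k (T% Y)
      ((extChartAt (𝓡 n) c).symm y)) :
    ContDiffAt ℝ k (coordRep c Y) y := by
  have hp := (extChartAt (𝓡 n) c).map_target hy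
  have hb : (extChartAt (𝓡 n) c).symm y ∈ (trivializationAt (EuclideanSpace ℝ (Fin n))
    (TangentSpace (𝓡 n) : M → Type _) c).baseSet := by simpa using hp
  have : IsManifold (𝓡 n) ((k : WithTop ℕ∞) + 1) M :=
    .of_le (n := ∞) (by exact_mod_cast le_top)
  rw [Trivialization.contMDiffAt_section_iff (IB := 𝓡 n)
    (trivializationAt (EuclideanSpace ℝ (Fin n)) (TangentSpace (𝓡 n) : M → Type _) c) hb] at hY
  have h2 := hY.comp y ((contMDiffAt_extChartAt_symm_of_mem hy).of_le (by exact_mod_cast le_top))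
  refine (contMDiffAt_iff_contDiffAt.1 h2).congr_of_eventuallyEq ?_
  filter_upwards [(isOpen_extChartAt_target c).mem_nhds hy] with z hz
  have hz' := (extChartAt (𝓡 n) c).map_target hz
  have hbz : (extChartAt (𝓡 n) c).symm z ∈ (trivializationAt (EuclideanSpace ℝ (Fin n))
    (TangentSpace (𝓡 n) : M → Type _) c).baseSet := by simpa using hz'
  simp only [coordRep, coordComp, Trivialization.continuousLinearMapAt_apply, Function.comp]
  rw [Trivialization.linearMapAt_apply, if_pos hbz]

theorem mvfderiv_coordField {F : Type*} [NormedAddCommGroup F] [NormedSpace ℝ F] {h : M → F}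
    (hp : p ∈ (extChartAt (𝓡 n) c).source) (hh : MDifferentiableAt (𝓡 n) 𝓘(ℝ, F) h p) (u : EuclideanSpace ℝ (Fin n)) :
    mvfderiv (𝓡 n) h p (coordField c u p) =
      fderiv ℝ (h ∘ (extChartAt (𝓡 n) c).symm) (extChartAt (𝓡 n) c p) u := by
  obtain ⟨y, hy, rfl⟩ : ∃ y ∈ (extChartAt (𝓡 n) c).target, (extChartAt (𝓡 n) c).symm y = p :=
    ⟨_, (extChartAt (𝓡 n) c).map_source hp, (extChartAt (𝓡 n) c).left_inv hp⟩
  have hs := (contMDiffAt_extChartAt_symm_of_mem hy).mdifferentiableAt (by simp)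
  rw [coordField_symm hy, (extChartAt (𝓡 n) c).right_inv hy, ← mfderiv_eq_fderiv,
    mfderiv_comp y hh hs]
  rfl

theorem mvfderiv_apply_eq {F : Type*} [NormedAddCommGroup F] [NormedSpace ℝ F] {h : M → F}
    (hp : p ∈ (extChartAt (𝓡 n) c).source) (hh : MDifferentiableAt (𝓡 n) 𝓘(ℝ, F) h p) (v : TangentSpace (𝓡 n) p) :
    mvfderiv (𝓡 n) h p v =
      fderiv ℝ (h ∘ (extChartAt (𝓡 n) c).symm) (extChartAt (𝓡 n) c p) (coordComp c p v) := by
  conv_lhs => rw [← coordField_coordComp hp v]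
  exact mvfderiv_coordField hp hh _

theorem mfderiv_symm_inverse_apply {y : EuclideanSpace ℝ (Fin n)}
    (hy : y ∈ (extChartAt (𝓡 n) c).target) (v : TangentSpace (𝓡 n) ((extChartAt (𝓡 n) c).symm y)) :
    (mfderiv 𝓘(ℝ, EuclideanSpace ℝ (Fin n)) (𝓡 n) (extChartAt (𝓡 n) c).symm y).inverse v =
      coordComp c ((extChartAt (𝓡 n) c).symm y) v := by
  have hp := (extChartAt (𝓡 n) c).map_target hy
  have hinv := isInvertible_mfderivWithin_extChartAt_symm (I := 𝓡 n) hy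
  simp only [modelWithCornersSelf_coe, Set.range_id, mfderivWithin_univ] at hinv
  have : v = mfderiv 𝓘(ℝ, EuclideanSpace ℝ (Fin n)) (𝓡 n) (extChartAt (𝓡 n) c).symm y
      (coordComp c ((extChartAt (𝓡 n) c).symm y) v) := by
    have h1 := coordField_eq_mfderiv hp (coordComp c ((extChartAt (𝓡 n) c).symm y) v)
    rw [coordField_coordComp hp, (extChartAt (𝓡 n) c).right_inv hy] at h1
    exact h1
  conv_lhs => rw [this]
  exact hinv.inverse_apply_self _

theorem mlieBracket_eq_lieBracket {E : Type*} [NormedAddCommGroup E] [NormedSpace ℝ E]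
    (V W : ∀ x : E, TangentSpace 𝓘(ℝ, E) x) (x : E) :
    mlieBracket 𝓘(ℝ, E) V W x = lieBracket ℝ V W x := by
  rw [← mlieBracketWithin_univ, mlieBracketWithin_eq_lieBracketWithin]
  exact congrFun lieBracketWithin_univ x

/-- Brackets commute with pullback along the inverse chart. There the coordinate field is constant,
so only the derivative of the components of `Y` survives. -/
theorem mlieBracket_coordField {Y : ∀ p : M, TangentSpace (𝓡 n) p}
    (hp : p ∈ (extChartAt (𝓡 n) c).source) (hY : VDiffAt Y p)
    (u : EuclideanSpace ℝ (Fin n)) :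
    mlieBracket (𝓡 n) (coordField c u) Y p =
      coordField c (fderiv ℝ (coordRep c Y) (extChartAt (𝓡 n) c p) u) p := by
  obtain ⟨y, hy, rfl⟩ : ∃ y ∈ (extChartAt (𝓡 n) c).target, (extChartAt (𝓡 n) c).symm y = p :=
    ⟨_, (extChartAt (𝓡 n) c).map_source hp, (extChartAt (𝓡 n) c).left_inv hp⟩
  rw [(extChartAt (𝓡 n) c).right_inv hy]
  have : IsManifold (𝓡 n) (minSmoothness ℝ 2) M := by simp; infer_instance
  have h := mpullback_mlieBracket (I := 𝓘(ℝ, EuclideanSpace ℝ (Fin n))) (I' := 𝓡 n)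
    (f := (extChartAt (𝓡 n) c).symm) (V := coordField c u) (W := Y) (x₀ := y) (n := ∞)
    (mdifferentiableAt_coordField hp u) hY
    (contMDiffAt_extChartAt_symm_of_mem hy)
    (by simpa using (ENat.LEInfty.out : (2 : WithTop ℕ∞) ≤ ∞))
  rw [mpullback_apply, mfderiv_symm_inverse_apply hy] at h
  replace h := h.trans (mlieBracket_eq_lieBracket _ _ _)
  have hV : mpullback 𝓘(ℝ, EuclideanSpace ℝ (Fin n)) (𝓡 n) (extChartAt (𝓡 n) c).symm
      (coordField c u) =ᶠ[𝓝 y] fun _ => u := by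
    filter_upwards [(isOpen_extChartAt_target c).mem_nhds hy] with z hz
    rw [mpullback_apply, mfderiv_symm_inverse_apply hz]
    exact coordComp_coordField ((extChartAt (𝓡 n) c).map_target hz) u
  have hW : mpullback 𝓘(ℝ, EuclideanSpace ℝ (Fin n)) (𝓡 n) (extChartAt (𝓡 n) c).symm Y
      =ᶠ[𝓝 y] coordRep c Y := by
    filter_upwards [(isOpen_extChartAt_target c).mem_nhds hy] with z hz
    rw [mpullback_apply, mfderiv_symm_inverse_apply hz]
    rfl
  have h2 := Filter.EventuallyEq.lieBracket_vectorField_eq (𝕜 := ℝ) hV hW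
  have h3 := h.trans h2
  rw [lieBracket] at h3
  simp only [fderiv_fun_const, Pi.zero_apply, _root_.zero_apply, sub_zero] at h3
  rw [← h3]
  exact (coordField_coordComp hp _).symm

end Coordinates

/-! ### Gram determinants, volume forms and traces. -/

section LinearAlgebra

variable {n : ℕ} {E : Type*} [NormedAddCommGroup E] [InnerProductSpace ℝ E]

/-- Jacobi's formula. The determinant is multilinear in the rows, so its derivative replaces one row
at a time; Cramer's rule writes each such determinant through the adjugate. -/
theorem hasFDerivAt_det {F : Type*} [NormedAddCommGroup F] [NormedSpace ℝ F]
    {G : F → Matrix (Fin n) (Fin n) ℝ} {G' : Fin n → Fin n → F →L[ℝ] ℝ} {x : F}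
    (h : ∀ i j, HasFDerivAt (fun y => G y i j) (G' i j) x) :
    HasFDerivAt (fun y => (G y).det) (∑ i, ∑ j, (G x).adjugate j i • G' i j) x := by
  let D : ContinuousMultilinearMap ℝ (fun _ : Fin n => Fin n → ℝ) ℝ :=
    { toMultilinearMap := (Matrix.detRowAlternating (n := Fin n) (R := ℝ)).toMultilinearMap
      cont := Continuous.matrix_det (A := fun M : Matrix (Fin n) (Fin n) ℝ => M) continuous_id }
  have h1 : HasFDerivAt (fun y => (G y : Fin n → Fin n → ℝ))
      (ContinuousLinearMap.pi fun i => ContinuousLinearMap.pi fun j => G' i j) x :=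
    hasFDerivAt_pi.2 fun i => hasFDerivAt_pi.2 fun j => h i j
  have h2 := (D.hasFDerivAt (G x)).comp x h1
  refine h2.congr_fderiv ?_
  ext v
  rw [ContinuousLinearMap.comp_apply]
  refine (D.linearDeriv_apply _ _).trans ?_
  simp only [_root_.sum_apply, _root_.smul_apply]
  refine Finset.sum_congr rfl fun i _ => ?_
  have h3 : D (Function.update (G x) i fun j => G' i j v) =
      ((G x).updateRow i fun j => G' i j v).det := rfl
  have h4 := Matrix.cramer_transpose_apply (G x) (fun j => G' i j v) i
  rw [Matrix.cramer_eq_adjugate_mulVec, ← Matrix.adjugate_transpose] at h4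
  exact h3.trans (h4.symm.trans rfl)

/-- The Gram determinant. -/
def gramDet (v : Fin n → E) : ℝ := (Matrix.gram ℝ v).det

/-- Dimension zero is separate: there an orientation is a bare sign, and only in positive dimension
is there always an orthonormal basis adapted to it. -/
theorem orientation_eq_rayOfNeZero_volumeForm [Fact (Module.finrank ℝ E = n)] (o : Orientation ℝ E (Fin n)) :
    ∃ h : o.volumeForm ≠ 0, o = rayOfNeZero ℝ o.volumeForm h := by
  rcases n with - | n
  · have h1 : (AlternatingMap.constLinearEquivOfIsEmpty (1 : ℝ) : E [⋀^Fin 0]→ₗ[ℝ] ℝ) ≠ 0 :=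
      AlternatingMap.constLinearEquivOfIsEmpty.injective.ne (by exact one_ne_zero)
    refine o.eq_or_eq_neg_of_isEmpty.elim ?_ ?_
    · rintro rfl
      exact ⟨by rw [Orientation.volumeForm_zero_pos]; exact h1,
        by simp only [Orientation.volumeForm_zero_pos]; rfl⟩
    · rintro rfl
      exact ⟨by rw [Orientation.volumeForm_zero_neg]; exact neg_ne_zero.2 h1,
        by simp only [Orientation.volumeForm_zero_neg]; exact neg_rayOfNeZero ℝ _ h1⟩
  · have hb := o.finOrthonormalBasis_orientation n.succ_pos Fact.out
    have h := o.volumeForm_robust _ hb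
    exact ⟨by rw [h]; exact Module.Basis.det_ne_zero _, by simp only [h]; exact hb.symm⟩

/-- If `B` holds the components of `v` in an orthonormal basis, the volume form is `± det B` while
the Gram matrix is `Bᵀ B`. -/
theorem abs_volumeForm_eq [Fact (Module.finrank ℝ E = n)] (o : Orientation ℝ E (Fin n))
    (b : OrthonormalBasis (Fin n) ℝ E) (v : Fin n → E) : |o.volumeForm v| = √(gramDet v) := by
  rw [o.volumeForm_robust' b, gramDet, Matrix.gram_eq_conjTranspose_mul b,  Matrix.det_mul, 
    Matrix.det_conjTranspose, star_trivial, Real.sqrt_mul_self_eq_abs]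
  rfl

theorem gramDet_pos {v : Fin n → E} (hv : LinearIndependent ℝ v) : 0 < gramDet v :=
  (Matrix.posDef_gram_of_linearIndependent hv).det_pos

/-- With `l` the matrix of `L`, the inner products form `lᵀ G + G l`. Since `adj(G) G = G adj(G) =
det G`, each summand contributes `tr l · det G`. This evaluates Jacobi's formula for a Gram matrix.
-/
theorem sum_adjugate_gram (b : Module.Basis (Fin n) ℝ E) (L : E →ₗ[ℝ] E) :
    ∑ i, ∑ j, (Matrix.gram ℝ b).adjugate j i * (inner ℝ (L (b i)) (b j) + inner ℝ (b i) (L (b j))) =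
      2 * LinearMap.trace ℝ E L * gramDet b := by
  set G := Matrix.gram ℝ b with hG
  set l := LinearMap.toMatrix b b L with hl
  have hL : ∀ i, L (b i) = ∑ k, l k i • b k := fun i => by
    conv_lhs => rw [← b.sum_repr (L (b i))]
    simp [hl, LinearMap.toMatrix_apply]
  have h1 : ∀ i j, inner ℝ (L (b i)) (b j) + inner ℝ (b i) (L (b j)) = (l.transpose * G + G * l) i j := by
    intro i j
    rw [hL i, hL j, sum_inner, inner_sum]
    simp [Matrix.mul_apply, inner_smul_left, inner_smul_right, hG, Matrix.gram_apply, mul_comm]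
  have h2 : ∑ i, ∑ j, G.adjugate j i * (inner ℝ (L (b i)) (b j) + inner ℝ (b i) (L (b j))) =
      (G.adjugate * (l.transpose * G + G * l)).trace := by
    rw [Finset.sum_comm]
    simp only [h1, Matrix.trace, Matrix.diag_apply, Matrix.mul_apply]
  rw [h2, mul_add, Matrix.trace_add, ← mul_assoc, Matrix.trace_mul_comm, ← mul_assoc,
    Matrix.mul_adjugate, ← mul_assoc, Matrix.adjugate_mul, LinearMap.trace_eq_matrix_trace ℝ b, ← hl,
    gramDet, ← hG]
  simp
  ring

/-- Expanding `L (b i)` in the basis, every off-diagonal term repeats a basis vector and vanishes.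
-/
theorem sum_alternating_update (b : Module.Basis (Fin n) ℝ E) (η : E [⋀^Fin n]→ₗ[ℝ] ℝ)
    (L : E →ₗ[ℝ] E) :
    ∑ i, η (Function.update b i (L (b i))) = LinearMap.trace ℝ E L * η b := by
  rw [LinearMap.trace_eq_matrix_trace ℝ b, Matrix.trace, Finset.sum_mul]
  refine Finset.sum_congr rfl fun i _ => ?_
  have hL : L (b i) = ∑ k, LinearMap.toMatrix b b L k i • b k := by
    conv_lhs => rw [← b.sum_repr (L (b i))]
    simp [LinearMap.toMatrix_apply]
  rw [hL, AlternatingMap.map_update_sum, Finset.sum_eq_single i]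
  · simp [AlternatingMap.map_update_smul]
  · intro k _ hk
    rw [AlternatingMap.map_update_smul, AlternatingMap.map_update_self _ _ hk.symm, smul_zero]
  · simp

end LinearAlgebra

theorem sign_mul_of_pos {r : ℝ} (hr : 0 < r) (a : ℝ) : Real.sign (r * a) = Real.sign a := by
  rcases lt_trichotomy a 0 with h | rfl | h
  · rw [Real.sign_of_neg h, Real.sign_of_neg (mul_neg_of_pos_of_neg hr h)]
  · simp
  · rw [Real.sign_of_pos h, Real.sign_of_pos (mul_pos hr h)]

theorem sign_mul_abs_self (a : ℝ) : Real.sign a * |a| = a := by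
  rcases lt_trichotomy a 0 with h | rfl | h
  · rw [Real.sign_of_neg h, abs_of_neg h]; ring
  · simp
  · rw [Real.sign_of_pos h, abs_of_pos h, one_mul]

/-! ### Local behaviour of the volume form on a frame. -/

section Volume

theorem VDiffAt.continuousAt_coordComp {n : ℕ} {M : Type*} [TopologicalSpace M]
    [ChartedSpace (EuclideanSpace ℝ (Fin n)) M] [IsManifold (𝓡 n) ∞ M]
    {V : ∀ p : M, TangentSpace (𝓡 n) p} {x : M}
    (hV : VDiffAt V x) : ContinuousAt (fun p => coordComp x p (V p)) x := by
  have hb := FiberBundle.mem_baseSet_trivializationAt' (F := EuclideanSpace ℝ (Fin n)) (E := (TangentSpace (𝓡 n) : M → Type _)) x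
  have h := ((mdifferentiableAt_totalSpace _ _).1 hV).2.continuousAt
  refine h.congr ?_
  filter_upwards [(trivializationAt (EuclideanSpace ℝ (Fin n))
    (TangentSpace (𝓡 n) : M → Type _) x).open_baseSet.mem_nhds hb] with p hp
  simp only [coordComp, Trivialization.continuousLinearMapAt_apply]
  rw [Trivialization.linearMapAt_apply, if_pos hp]


variable {n : ℕ} {M : Type*} [TopologicalSpace M] [ChartedSpace (EuclideanSpace ℝ (Fin n)) M]
  [IsManifold (𝓡 n) ∞ M] [RiemannianBundle (fun x : M => TangentSpace (𝓡 n) x)]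

/-- In a trivialization, the volume form is locally a positive multiple of a constant form. -/
theorem eventually_volForm_eq (o : ManifoldOrientation n M) (x : M) :
    ∃ η : EuclideanSpace ℝ (Fin n) [⋀^Fin n]→ₗ[ℝ] ℝ, ∀ᶠ p in 𝓝 x, ∃ r > 0,
      ∀ v : Fin n → TangentSpace (𝓡 n) p, volForm o p v = r * η (fun i => coordComp x p (v i)) := by
  obtain ⟨o₀, h⟩ := o.locallyConstant x
  induction o₀ using Module.Ray.ind with | h η hη => ?_
  refine ⟨η, ?_⟩
  filter_upwards [h, (trivializationAt (EuclideanSpace ℝ (Fin n))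
    (TangentSpace (𝓡 n) : M → Type _) x).open_baseSet.mem_nhds
    (FiberBundle.mem_baseSet_trivializationAt' x)] with p hp hpb
  specialize hp hpb
  obtain ⟨h0, h1⟩ := orientation_eq_rayOfNeZero_volumeForm (o.orient p)
  rw [h1, Orientation.map_apply, ray_eq_iff] at hp
  -- Equality of orientations is equality of rays, so the representing forms differ by a positive
  -- factor.
  obtain ⟨r, hr, h2⟩ := hp.symm.exists_pos_left hη ((mt (AlternatingMap.compLinearEquiv_eq_zero_iff _ _).mp h0))
  refine ⟨r, hr, fun v => ?_⟩
  have h3 := congrArg (fun ω' => ω' (fun i => coordComp x p (v i))) h2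
  simp only [AlternatingMap.smul_apply, smul_eq_mul, AlternatingMap.compLinearMap_apply] at h3
  rw [h3]
  change _ = (o.orient p).volumeForm _
  unfold volForm
  congr 1
  ext1 i
  have h4 := congrFun (Trivialization.symm_continuousLinearEquivAt_eq (R := ℝ)
    (trivializationAt (EuclideanSpace ℝ (Fin n)) (TangentSpace (𝓡 n) : M → Type _) x) hpb)
    (coordComp x p (v i))
  refine Eq.trans ?_ h4.symm
  exact (coordField_coordComp (by simpa using hpb) _).symm

/-- The orientation is only known to be locally constant. This gives a locally constant sign on a
continuous frame, while the absolute value is read off from the metric; differentiability of the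
volume form can then come from the Gram determinant. -/
theorem eventually_volForm_eq_sign_mul (o : ManifoldOrientation n M) {x : M}
    {V : Fin n → ∀ p : M, TangentSpace (𝓡 n) p} (hV : ∀ i, VDiffAt (V i) x)
    (h0 : volForm o x (fun i => V i x) ≠ 0) :
    ∀ᶠ p in 𝓝 x, volForm o p (fun i => V i p) =
      Real.sign (volForm o x fun i => V i x) * √(gramDet fun i => V i p) := by
  obtain ⟨η, hη⟩ := eventually_volForm_eq o x
  have hcont : ContinuousAt (fun p => η (fun i => coordComp x p (V i p))) x := by
    have h1 : ContinuousAt (fun p => fun i => coordComp x p (V i p)) x :=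
      continuousAt_pi.2 fun i => (hV i).continuousAt_coordComp
    have h2 : Continuous η := by
      rw [AlternatingMap.eq_smul_basis_det (EuclideanSpace.basisFun (Fin n) ℝ).toBasis η]
      change Continuous fun m : Fin n → EuclideanSpace ℝ (Fin n) =>
        η (EuclideanSpace.basisFun (Fin n) ℝ).toBasis * (EuclideanSpace.basisFun (Fin n) ℝ).toBasis.det m
      simp only [Module.Basis.det_apply]
      refine continuous_const.mul (Continuous.matrix_det ?_)
      refine continuous_pi fun i => continuous_pi fun j => ?_
      refine (by fun_prop : Continuous fun m : Fin n → EuclideanSpace ℝ (Fin n) => m j i).congr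
        fun m => ?_
      simp [Module.Basis.toMatrix_apply]
    exact h2.continuousAt.comp h1
  obtain ⟨r₀, hr₀, hx⟩ := hη.self_of_nhds
  have h0' : η (fun i => coordComp x x (V i x)) ≠ 0 := fun h => h0 (by rw [hx, h, mul_zero])
  have hsign : ∀ᶠ p in 𝓝 x, Real.sign (η (fun i => coordComp x p (V i p))) =
      Real.sign (η (fun i => coordComp x x (V i x))) := by
    rcases lt_or_gt_of_ne h0' with h | h
    · filter_upwards [hcont.eventually_lt_const h] with p hp
      rw [Real.sign_of_neg hp, Real.sign_of_neg h]
    · filter_upwards [hcont.eventually_const_lt h] with p hp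
      rw [Real.sign_of_pos hp, Real.sign_of_pos h]
  filter_upwards [hη, hsign] with p ⟨r, hr, hp⟩ hs
  have habs := abs_volumeForm_eq (o.orient p) (orthoFrame p) (fun i => V i p)
  have : Real.sign (volForm o p fun i => V i p) = Real.sign (volForm o x fun i => V i x) := by
    rw [hp, hx, sign_mul_of_pos hr, sign_mul_of_pos hr₀, hs]
  rw [← this, ← habs]
  exact (sign_mul_abs_self _).symm

end Volume

theorem _root_.Filter.EventuallyEq.mvfderiv_eq {n : ℕ} {M : Type*} [TopologicalSpace M]
    [ChartedSpace (EuclideanSpace ℝ (Fin n)) M] {F : Type*} [NormedAddCommGroup F]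
    [NormedSpace ℝ F] {p : M} {h₁ h₂ : M → F} (hh : h₁ =ᶠ[𝓝 p] h₂) :
    mvfderiv (𝓡 n) h₁ p = mvfderiv (𝓡 n) h₂ p := by
  ext v
  exact congrArg (fun A : EuclideanSpace ℝ (Fin n) →L[ℝ] F => A v) hh.mfderiv_eq

/-! ### Differentiability on the manifold versus in a chart. -/

section ChartDerivative

variable {n : ℕ} {M : Type*} [TopologicalSpace M] [ChartedSpace (EuclideanSpace ℝ (Fin n)) M]
  [IsManifold (𝓡 n) ∞ M] {F : Type*} [NormedAddCommGroup F] [NormedSpace ℝ F] {c p : M} {h : M → F}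

theorem exists_vDiffAt_extension (v : TangentSpace (𝓡 n) p) :
    ∃ V : ∀ q : M, TangentSpace (𝓡 n) q, VDiffAt V p ∧ V p = v :=
  ⟨FiberBundle.extend (EuclideanSpace ℝ (Fin n)) v,
    FiberBundle.mdifferentiableAt_extend .., FiberBundle.extend_apply_self (EuclideanSpace ℝ (Fin n)) v⟩

theorem differentiableAt_comp_symm (hp : p ∈ (extChartAt (𝓡 n) c).source)
    (hh : MDifferentiableAt (𝓡 n) 𝓘(ℝ, F) h p) :
    DifferentiableAt ℝ (h ∘ (extChartAt (𝓡 n) c).symm) (extChartAt (𝓡 n) c p) := by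
  rw [← mdifferentiableAt_iff_differentiableAt]
  have hs := (contMDiffAt_extChartAt_symm_of_mem
    ((extChartAt (𝓡 n) c).map_source hp)).mdifferentiableAt (by simp)
  have e1 := (extChartAt (𝓡 n) c).left_inv hp
  exact MDifferentiableAt.comp_of_eq (x := extChartAt (𝓡 n) c p) hh hs e1

theorem mdifferentiableAt_of_comp_symm (hp : p ∈ (extChartAt (𝓡 n) c).source)
    (hh : DifferentiableAt ℝ (h ∘ (extChartAt (𝓡 n) c).symm) (extChartAt (𝓡 n) c p)) :
    MDifferentiableAt (𝓡 n) 𝓘(ℝ, F) h p := by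
  have hs := mdifferentiableAt_extChartAt (I := 𝓡 n) (x := c) (y := p) (by simpa using hp)
  refine (hh.mdifferentiableAt.comp p hs).congr_of_eventuallyEq ?_
  filter_upwards [(isOpen_extChartAt_source (I := 𝓡 n) c).mem_nhds hp] with q hq
  simp only [Function.comp_apply, (extChartAt (𝓡 n) c).left_inv hq]

end ChartDerivative

/-! ### Divergence as the trace of `∇Y`, the symmetrized derivative, and the trace formula. -/

section LeviCivitaAPI

variable {n : ℕ} {M : Type*} [TopologicalSpace M] [ChartedSpace (EuclideanSpace ℝ (Fin n)) M]
  [IsManifold (𝓡 n) ∞ M] [RiemannianBundle (fun x : M => TangentSpace (𝓡 n) x)]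
  [IsContMDiffRiemannianBundle (𝓡 n) ∞ (EuclideanSpace ℝ (Fin n))
    (fun x : M => TangentSpace (𝓡 n) x)]

variable {x : M}

theorem mdifferentiableAt_inner {Y Z : ∀ p : M, TangentSpace (𝓡 n) p}
    (hY : VDiffAt Y x) (hZ : VDiffAt Z x) :
    MDifferentiableAt (𝓡 n) 𝓘(ℝ, ℝ) (fun p => (inner ℝ (Y p) (Z p) : ℝ)) x :=
  mdiffAt_inner hY hZ

theorem mvfderiv_inner {Y Z : ∀ p : M, TangentSpace (𝓡 n) p}
    (hY : VDiffAt Y x) (hZ : VDiffAt Z x) (w : TangentSpace (𝓡 n) x) :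
    mvfderiv (𝓡 n) (fun p => (inner ℝ (Y p) (Z p) : ℝ)) x w =
      inner ℝ (nabla (𝓡 n) Y x w) (Z x) + inner ℝ (Y x) (nabla (𝓡 n) Z x w) := by
  obtain ⟨W, hW, rfl⟩ := exists_vDiffAt_extension w
  exact leviCivita_inner hW hY hZ

theorem mlieBracket_eq_nabla {X Y : ∀ p : M, TangentSpace (𝓡 n) p}
    (hX : VDiffAt X x) (hY : VDiffAt Y x) :
    mlieBracket (𝓡 n) X Y x = nabla (𝓡 n) Y x (X x) - nabla (𝓡 n) X x (Y x) :=
  ((CovariantDerivative.torsion_eq_zero_iff _).1 (leviCivita_torsion (I := 𝓡 n) (M := M)) hX hY).symm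

/-- Metric compatibility makes the derivative of the Gram entries `g(L b_i, b_j) + g(b_i, L b_j)`;
Jacobi's formula and `sum_adjugate_gram` conclude. -/
theorem mvfderiv_gramDet {V : Fin n → ∀ p : M, TangentSpace (𝓡 n) p} (hV : ∀ i, VDiffAt (V i) x)
    (b : Module.Basis (Fin n) ℝ (TangentSpace (𝓡 n) x)) (hb : ∀ i, b i = V i x)
    (w : TangentSpace (𝓡 n) x) (L : TangentSpace (𝓡 n) x →ₗ[ℝ] TangentSpace (𝓡 n) x)
    (hL : ∀ i, L (b i) = nabla (𝓡 n) (V i) x w) :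
    MDifferentiableAt (𝓡 n) 𝓘(ℝ, ℝ) (fun p => gramDet (fun i => V i p)) x ∧
    mvfderiv (𝓡 n) (fun p => gramDet (fun i => V i p)) x w =
      2 * LinearMap.trace ℝ _ L * gramDet (fun i => V i x) := by
  have hp : x ∈ (extChartAt (𝓡 n) x).source := mem_extChartAt_source x
  have hd := hasFDerivAt_det
    (G := fun y => Matrix.gram ℝ fun i => V i ((extChartAt (𝓡 n) x).symm y))
    (x := extChartAt (𝓡 n) x x) fun i j =>
      (differentiableAt_comp_symm hp (mdifferentiableAt_inner (hV i) (hV j))).hasFDerivAt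
  have hm : MDifferentiableAt (𝓡 n) 𝓘(ℝ, ℝ) (fun p => gramDet (fun i => V i p)) x :=
    mdifferentiableAt_of_comp_symm hp hd.differentiableAt
  refine ⟨hm, ?_⟩
  rw [mvfderiv_apply_eq hp hm]
  have hd' := congrArg (fun A => A (coordComp x x w)) hd.fderiv
  refine Eq.trans hd' ?_
  simp only [_root_.sum_apply, _root_.smul_apply, smul_eq_mul]
  have hVb : (fun i => V i x) = b := funext fun i => (hb i).symm
  rw [extChartAt_to_inv, hVb, ← sum_adjugate_gram b L]
  refine Finset.sum_congr rfl fun i _ => Finset.sum_congr rfl fun j _ => ?_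
  rw [← mvfderiv_apply_eq hp (mdifferentiableAt_inner (hV i) (hV j)), mvfderiv_inner (hV i) (hV j),
    hL, hL, hb, hb]

/-- This expresses that the volume form is parallel. Near `x` it is a constant sign times
`√gramDet`, and the square root halves the factor `2 tr L`. -/
theorem mvfderiv_volForm (o : ManifoldOrientation n M) {V : Fin n → ∀ p : M, TangentSpace (𝓡 n) p}
    (hV : ∀ i, VDiffAt (V i) x)
    (b : Module.Basis (Fin n) ℝ (TangentSpace (𝓡 n) x)) (hb : ∀ i, b i = V i x)
    (w : TangentSpace (𝓡 n) x) (L : TangentSpace (𝓡 n) x →ₗ[ℝ] TangentSpace (𝓡 n) x)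
    (hL : ∀ i, L (b i) = nabla (𝓡 n) (V i) x w) :
    mvfderiv (𝓡 n) (fun p => volForm o p (fun i => V i p)) x w =
      LinearMap.trace ℝ _ L * volForm o x (fun i => V i x) := by
  obtain ⟨hm, hg⟩ := mvfderiv_gramDet hV b hb w L hL
  have hVb : (fun i => V i x) = b := funext fun i => (hb i).symm
  have hpos : 0 < gramDet (fun i => V i x) := gramDet_pos (hVb ▸ b.linearIndependent)
  have habs : |volForm o x (fun i => V i x)| = √(gramDet fun i => V i x) :=
    abs_volumeForm_eq (o.orient x) (orthoFrame x) _
  have h0 : volForm o x (fun i => V i x) ≠ 0 := by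
    rw [← abs_pos, habs]
    exact Real.sqrt_pos.2 hpos
  have hev := eventually_volForm_eq_sign_mul o hV h0
  set s := Real.sign (volForm o x fun i => V i x)
  have hd : HasDerivAt (fun t => s * √t) (s * (1 / (2 * √(gramDet fun i => V i x))))
      (gramDet fun i => V i x) := (Real.hasDerivAt_sqrt hpos.ne').const_mul s
  have h1 : mvfderiv (𝓡 n) (fun p => volForm o p (fun i => V i p)) x =
      mvfderiv (𝓡 n) ((fun t => s * √t) ∘ fun p => gramDet (fun i => V i p)) x := by
    exact Filter.EventuallyEq.mvfderiv_eq hev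
  rw [h1, mvfderiv_comp_apply x hd.differentiableAt.mdifferentiableAt hm]
  change (mfderiv 𝓘(ℝ, ℝ) 𝓘(ℝ, ℝ) (fun t => s * √t) (gramDet fun i => V i x)) (mvfderiv (𝓡 n) (fun p => gramDet fun i => V i p) x w) = _
  rw [mfderiv_eq_fderiv, hg, hev.self_of_nhds]
  change (fderiv ℝ (fun t => s * √t) (gramDet fun i => V i x)) _ = _
  rw [hd.hasFDerivAt.fderiv]
  have hs : √(gramDet fun i => V i x) ≠ 0 := (Real.sqrt_pos.2 hpos).ne'
  simp only [ContinuousLinearMap.toSpanSingleton_apply, smul_eq_mul]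
  have hss := Real.mul_self_sqrt hpos.le
  field_simp
  rw [pow_two, hss]
  ring

/-- On a frame `V`, the two parts of `L_Y μ` are `tr L · μ` and `tr B · μ` with `L b_i = ∇_Y V_i`
and `B b_i = [Y, V_i]`. Vanishing torsion gives `(L - B) b_i = ∇_{b_i} Y`. -/
theorem divergence_eq_trace (o : ManifoldOrientation n M) {Y : ∀ p : M, TangentSpace (𝓡 n) p}
    (hY : VDiffAt Y x) :
    divergence o Y x = LinearMap.trace ℝ _ (nabla (𝓡 n) Y x : TangentSpace (𝓡 n) x →ₗ[ℝ] TangentSpace (𝓡 n) x) := by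
  set V : Fin n → ∀ p : M, TangentSpace (𝓡 n) p :=
    fun i => FiberBundle.extend (EuclideanSpace ℝ (Fin n)) (orthoFrame x i) with hVdef
  have hV : ∀ i, VDiffAt (V i) x := fun i => FiberBundle.mdifferentiableAt_extend ..
  have hVx : ∀ i, V i x = orthoFrame x i := fun i =>
    FiberBundle.extend_apply_self (EuclideanSpace ℝ (Fin n)) (orthoFrame x i)
  set b : Module.Basis (Fin n) ℝ (TangentSpace (𝓡 n) x) := (orthoFrame x).toBasis with hb
  have hbV : ∀ i, b i = V i x := fun i => by rw [hVx, hb, OrthonormalBasis.coe_toBasis]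
  have hbe : ⇑b = orthoFrame x := (orthoFrame x).coe_toBasis
  have hVe : (fun i => V i x) = orthoFrame x := funext hVx
  set L := b.constr ℝ fun i => nabla (𝓡 n) (V i) x (Y x)
  set B := b.constr ℝ fun i => mlieBracket (𝓡 n) Y (V i) x
  have hL : ∀ i, L (b i) = nabla (𝓡 n) (V i) x (Y x) := fun i => b.constr_basis ℝ _ i
  have hB : ∀ i, B (b i) = mlieBracket (𝓡 n) Y (V i) x := fun i => b.constr_basis ℝ _ i
  have hLB : L - B = (nabla (𝓡 n) Y x : TangentSpace (𝓡 n) x →ₗ[ℝ] TangentSpace (𝓡 n) x) := by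
    refine b.ext fun i => ?_
    rw [LinearMap.sub_apply, hL, hB, mlieBracket_eq_nabla hY (hV i), hbV]
    simp
  have h1 := mvfderiv_volForm o hV b hbV (Y x) L hL
  have h2 := sum_alternating_update b (volForm o x) B
  have h0 : volForm o x (orthoFrame x) ≠ 0 := by
    rw [← abs_pos]
    have := (o.orient x).abs_volumeForm_apply_of_orthonormal (orthoFrame x)
    exact this ▸ one_pos
  rw [divergence, div_eq_iff h0, lieDerivVol, ← hLB, map_sub, sub_mul]
  rw [hVe] at h1
  simp only [hB] at h2
  rw [hbe] at h2
  exact congrArg₂ (· - ·) h1 h2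

theorem oneFormDiffAt_flat {Y : ∀ p : M, TangentSpace (𝓡 n) p} (hY : VDiffAt Y x) :
    OneFormDiffAt (𝓡 n) (flat (𝓡 n) Y) x := by
  obtain ⟨g, hg, hg'⟩ := IsContMDiffRiemannianBundle.exists_contMDiff (IB := 𝓡 n) (n := ∞)
    (F := EuclideanSpace ℝ (Fin n)) (E := fun x : M => TangentSpace (𝓡 n) x)
  have h1 := (hg x).mdifferentiableAt (by simp)
  have h2 := MDifferentiableAt.clm_bundle_apply (F₁ := EuclideanSpace ℝ (Fin n)) (F₂ := EuclideanSpace ℝ (Fin n) →L[ℝ] ℝ)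
    (E₁ := fun x : M => TangentSpace (𝓡 n) x)
    (E₂ := fun x : M => TangentSpace (𝓡 n) x →L[ℝ] Bundle.Trivial M ℝ x)
      (b := fun p : M => p) h1 hY
  have : ∀ p, flat (𝓡 n) Y p = g p (Y p) := fun p => by
    ext v
    exact hg' p (Y p) v
  unfold OneFormDiffAt
  simp only [this]
  exact h2

/-- Parallelism of the metric: in `v(g(Y,W)) - g(Y, ∇_v W)` the terms containing `∇_v W` cancel. -/
theorem nablaForm_flat_apply {Y : ∀ p : M, TangentSpace (𝓡 n) p} (hY : VDiffAt Y x)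
    (v w : TangentSpace (𝓡 n) x) :
    nablaForm (𝓡 n) (flat (𝓡 n) Y) x v w = inner ℝ (nabla (𝓡 n) Y x v) w := by
  have hφ := oneFormDiffAt_flat hY
  obtain ⟨W, hW, rfl⟩ := exists_vDiffAt_extension w
  rw [nablaForm, dif_pos hφ, ContinuousLinearMap.flip_apply, TensorialAt.mkHom_apply _ hW]
  have h1 : mvfderiv (𝓡 n) (fun p => flat (𝓡 n) Y p (W p)) x v = _ := mvfderiv_inner hY hW v
  have h2 : flat (𝓡 n) Y x (leviCivita (𝓡 n) M W x v) = inner ℝ (Y x) (nabla (𝓡 n) W x v) := rfl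
  simp [h1, h2]

theorem nablaFormSym_flat_apply {Y : ∀ p : M, TangentSpace (𝓡 n) p} (hY : VDiffAt Y x)
    (v w : TangentSpace (𝓡 n) x) :
    nablaFormSym (𝓡 n) (flat (𝓡 n) Y) x v w =
      inner ℝ (nabla (𝓡 n) Y x v) w + inner ℝ (nabla (𝓡 n) Y x w) v := by
  rw [← nablaForm_flat_apply hY, ← nablaForm_flat_apply hY]
  rfl

theorem nablaFormSym_flat_eq_zero_iff {Y : ∀ p : M, TangentSpace (𝓡 n) p} (hY : VDiffAt Y x) :
    nablaFormSym (𝓡 n) (flat (𝓡 n) Y) x = 0 ↔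
      ∀ v : TangentSpace (𝓡 n) x, inner ℝ (nabla (𝓡 n) Y x v) v = 0 := by
  constructor
  · intro h v
    have h1 := nablaFormSym_flat_apply hY v v
    rw [h] at h1
    have h2 : (0 : ℝ) = _ := h1
    linarith
  · intro h
    ext v w
    rw [nablaFormSym_flat_apply hY]
    have h1 := h (v + w)
    rw [map_add, inner_add_left, inner_add_right, inner_add_right, h v, h w] at h1
    simpa using h1

theorem metricTrace_nablaFormSym_flat (o : ManifoldOrientation n M)
    {Y : ∀ p : M, TangentSpace (𝓡 n) p} (hY : VDiffAt Y x) :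
    metricTrace (nablaFormSym (𝓡 n) (flat (𝓡 n) Y) x) = 2 * divergence o Y x := by
  rw [divergence_eq_trace o hY, LinearMap.trace_eq_sum_inner _ (orthoFrame x), metricTrace,
    Finset.mul_sum]
  refine Finset.sum_congr rfl fun i _ => ?_
  rw [nablaFormSym_flat_apply hY, real_inner_comm, two_mul]
  rfl

theorem metricTrace_symDivTensor (o : ManifoldOrientation n M)
    {Y : ∀ p : M, TangentSpace (𝓡 n) p} (hY : VDiffAt Y x) :
    metricTrace (symDivTensor o Y x) = (n + 2) * divergence o Y x := by
  have h1 : metricTrace (symDivTensor o Y x) = metricTrace (nablaFormSym (𝓡 n) (flat (𝓡 n) Y) x) +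
      divergence o Y x * ∑ i : Fin n,
        (inner ℝ (orthoFrame (n := n) x i) (orthoFrame (n := n) x i) : ℝ) := by
    rw [metricTrace, metricTrace, Finset.mul_sum, ← Finset.sum_add_distrib]
    rfl
  rw [h1, metricTrace_nablaFormSym_flat o hY]
  simp [(orthoFrame (n := n) x).norm_eq_one]
  ring

/-- Taking traces, either condition forces `div Y = 0` at `x`, because `n + 2` and `2` are nonzero;
the two tensors then coincide there. -/
theorem symDivTensor_eq_zero_iff (o : ManifoldOrientation n M)
    {Y : ∀ p : M, TangentSpace (𝓡 n) p} (hY : VDiffAt Y x) :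
    symDivTensor o Y x = 0 ↔ nablaFormSym (𝓡 n) (flat (𝓡 n) Y) x = 0 := by
  have h0 : metricTrace (0 : TangentSpace (𝓡 n) x →L[ℝ] TangentSpace (𝓡 n) x →L[ℝ] ℝ) = 0 := by
    simp [metricTrace]
  have hdiv : divergence o Y x = 0 → symDivTensor o Y x =
      nablaFormSym (𝓡 n) (flat (𝓡 n) Y) x := fun h => by
    ext v w
    simp [symDivTensor, h]
  constructor
  · intro h
    have h1 := metricTrace_symDivTensor o hY
    rw [h, h0] at h1
    have h2 : divergence o Y x = 0 := by
      rcases mul_eq_zero.1 h1.symm with h3 | h3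
      · exact absurd h3 (by positivity)
      · exact h3
    rw [← hdiv h2, h]
  · intro h
    have h1 := metricTrace_nablaFormSym_flat o hY
    rw [h, h0] at h1
    rw [hdiv (by linarith), h]

end LeviCivitaAPI

/-! ### The Riemannian density in a chart. -/

section Density

variable {n : ℕ} {M : Type*} [TopologicalSpace M] [ChartedSpace (EuclideanSpace ℝ (Fin n)) M]
  [IsManifold (𝓡 n) ∞ M]

/-- The coordinate vectors of the chart around `c`, as a basis of the tangent space. -/
def coordBasis (c : M) {p : M} (hp : p ∈ (extChartAt (𝓡 n) c).source) :
    Module.Basis (Fin n) ℝ (TangentSpace (𝓡 n) p) :=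
  (EuclideanSpace.basisFun (Fin n) ℝ).toBasis.map
    ({ toFun := fun u => coordField c u p
       map_add' := fun u v => map_add _ u v
       map_smul' := fun r u => map_smul _ r u
       invFun := coordComp c p
       left_inv := coordComp_coordField hp
       right_inv := coordField_coordComp hp } :
      EuclideanSpace ℝ (Fin n) ≃ₗ[ℝ] TangentSpace (𝓡 n) p)

variable {c p : M}

theorem coordBasis_apply (hp : p ∈ (extChartAt (𝓡 n) c).source) (i : Fin n) :
    coordBasis c hp i = coordField c (EuclideanSpace.single i 1) p := by
  simp [coordBasis]
  rfl

theorem coordBasis_repr (hp : p ∈ (extChartAt (𝓡 n) c).source) (u : EuclideanSpace ℝ (Fin n))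
    (i : Fin n) : (coordBasis c hp).repr (coordField c u p) i = u i := by
  have h : (coordBasis c hp).repr (coordField c u p) i = coordComp c p (coordField c u p) i := by
    simp only [coordBasis, Module.Basis.map_repr, LinearEquiv.trans_apply]
    rfl
  rw [h, coordComp_coordField hp]

variable [RiemannianBundle (fun x : M => TangentSpace (𝓡 n) x)]

variable (n) in
/-- The density of the Riemannian volume in the chart around `c`. -/
def volDensity (c p : M) : ℝ :=
  √(gramDet fun i => coordField c (EuclideanSpace.single (i : Fin n) (1 : ℝ)) p)

theorem gramDet_coordField_pos (hp : p ∈ (extChartAt (𝓡 n) c).source) :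
    0 < gramDet fun i => coordField c (EuclideanSpace.single (i : Fin n) (1 : ℝ)) p := by
  have h : (fun i => coordField c (EuclideanSpace.single (i : Fin n) (1 : ℝ)) p) =
      coordBasis c hp := funext fun i => (coordBasis_apply hp i).symm
  rw [h]
  exact gramDet_pos (coordBasis c hp).linearIndependent

theorem volDensity_pos (hp : p ∈ (extChartAt (𝓡 n) c).source) : 0 < volDensity n c p :=
  Real.sqrt_pos.2 (gramDet_coordField_pos hp)

theorem abs_volForm_coordFrame (o : ManifoldOrientation n M) {y : EuclideanSpace ℝ (Fin n)}
    (hy : y ∈ (extChartAt (𝓡 n) c).target) :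
    |volForm o ((extChartAt (𝓡 n) c).symm y) (coordFrame c y)| =
      volDensity n c ((extChartAt (𝓡 n) c).symm y) := by
  have h : coordFrame c y = fun i =>
    coordField c (EuclideanSpace.single i (1 : ℝ)) ((extChartAt (𝓡 n) c).symm y) :=
    funext fun i => coordFrame_eq hy i
  rw [h]
  exact abs_volumeForm_eq (o.orient _) (orthoFrame (n := n) _) _

/-- The pullback of a volume form under `φ` has top degree, so precomposition with `S` multiplies it
by `det S`; the absolute values are the square roots of Gram determinants. -/
theorem gramDet_comp_linearMap {V : Type*} [NormedAddCommGroup V] [InnerProductSpace ℝ V]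
    [Fact (Module.finrank ℝ V = n)] (b : OrthonormalBasis (Fin n) ℝ V)
    (φ : EuclideanSpace ℝ (Fin n) →ₗ[ℝ] V)
    (S : EuclideanSpace ℝ (Fin n) →ₗ[ℝ] EuclideanSpace ℝ (Fin n)) :
    √(gramDet fun i => φ (S (EuclideanSpace.single i 1))) =
      |LinearMap.det S| * √(gramDet fun i => φ (EuclideanSpace.single (i : Fin n) (1 : ℝ))) := by
  set o := b.toBasis.orientation
  rw [← abs_volumeForm_eq o b, ← abs_volumeForm_eq o b, ← abs_mul]
  congr 1
  set e := (EuclideanSpace.basisFun (Fin n) ℝ).toBasis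
  have he : ∀ i, e i = EuclideanSpace.single i 1 := fun i => by simp [e]
  have h1 := AlternatingMap.eq_smul_basis_det e (o.volumeForm.compLinearMap φ)
  have h2 := congrArg (fun η => η (S ∘ e)) h1
  simp only [AlternatingMap.smul_apply, smul_eq_mul, AlternatingMap.compLinearMap_apply,
    Module.Basis.det_comp, Module.Basis.det_self, mul_one, Function.comp_apply, he] at h2
  rw [mul_comm]
  exact h2

/-- The derivative of the transition map carries components in the chart `c` to components in the
chart `d`. This is the factor that the change of variables formula absorbs. -/
theorem volDensity_eq_abs_det_mul {d : M} (hc : p ∈ (extChartAt (𝓡 n) c).source)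
    (hd : p ∈ (extChartAt (𝓡 n) d).source) :
    volDensity n c p = |(fderiv ℝ (extChartAt (𝓡 n) d ∘ (extChartAt (𝓡 n) c).symm)
      (extChartAt (𝓡 n) c p)).det| * volDensity n d p := by
  have hu : ∀ u, coordField c u p = coordField d (fderiv ℝ
      (extChartAt (𝓡 n) d ∘ (extChartAt (𝓡 n) c).symm) (extChartAt (𝓡 n) c p) u) p := by
    intro u
    have hm := mdifferentiableAt_extChartAt (I := 𝓡 n) (x := d) (y := p) (by simpa using hd)
    rw [← mvfderiv_coordField hc hm u]
    conv_lhs => rw [← coordField_coordComp hd (coordField c u p), coordComp_eq_mfderiv hd]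
    rfl
  have h := gramDet_comp_linearMap (orthoFrame (n := n) p)
    ((trivializationAt (EuclideanSpace ℝ (Fin n)) (TangentSpace (𝓡 n) : M → Type _) d).symmL ℝ p).toLinearMap
    (fderiv ℝ (extChartAt (𝓡 n) d ∘ (extChartAt (𝓡 n) c).symm) (extChartAt (𝓡 n) c p)).toLinearMap
  unfold volDensity
  simp only [hu]
  exact h

variable [IsContMDiffRiemannianBundle (𝓡 n) ∞ (EuclideanSpace ℝ (Fin n))
    (fun x : M => TangentSpace (𝓡 n) x)]

theorem contDiffAt_inner_comp_symm {U V : ∀ p : M, TangentSpace (𝓡 n) p}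
    (hp : p ∈ (extChartAt (𝓡 n) c).source)
    (hU : ContMDiffAt (𝓡 n) ((𝓡 n).prod 𝓘(ℝ, EuclideanSpace ℝ (Fin n))) ∞ (T% U) p)
    (hV : ContMDiffAt (𝓡 n) ((𝓡 n).prod 𝓘(ℝ, EuclideanSpace ℝ (Fin n))) ∞ (T% V) p) :
    ContDiffAt ℝ ∞ ((fun q => (inner ℝ (U q) (V q) : ℝ)) ∘ (extChartAt (𝓡 n) c).symm)
      (extChartAt (𝓡 n) c p) := by
  have h : ContMDiffAt (𝓡 n) 𝓘(ℝ, ℝ) ∞ (fun q => (inner ℝ (U q) (V q) : ℝ)) p :=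
    ContMDiffAt.inner_bundle (IB := 𝓡 n) (F := EuclideanSpace ℝ (Fin n))
      (E := fun x : M => TangentSpace (𝓡 n) x) hU hV
  rw [← contMDiffAt_iff_contDiffAt]
  refine ContMDiffAt.comp_of_eq h (contMDiffAt_extChartAt_symm_of_mem
    ((extChartAt (𝓡 n) c).map_source hp)) ((extChartAt (𝓡 n) c).left_inv hp)

theorem contDiffAt_volDensity (hp : p ∈ (extChartAt (𝓡 n) c).source) :
    ContDiffAt ℝ ∞ (fun y => volDensity n c ((extChartAt (𝓡 n) c).symm y))
      (extChartAt (𝓡 n) c p) := by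
  have h0 := gramDet_coordField_pos hp
  refine ContDiffAt.sqrt ?_ (by rw [(extChartAt (𝓡 n) c).left_inv hp]; exact h0.ne')
  unfold gramDet
  simp only [Matrix.det_apply]
  refine ContDiffAt.sum fun σ _ => ContDiffAt.const_smul _ (contDiffAt_prod fun i _ => ?_)
  exact contDiffAt_inner_comp_symm hp (contMDiffAt_coordField hp _) (contMDiffAt_coordField hp _)

/-- Split `∇W = L - B` on the coordinate frame, as in `divergence_eq_trace`. Then `tr L · √g` is the
derivative of `√g` along `W`, and `[W, ∂_i] = -∂_i W` gives `tr B = -∑ ∂_i W^i`. -/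
theorem divergence_mul_volDensity (o : ManifoldOrientation n M)
    {W : ∀ p : M, TangentSpace (𝓡 n) p} (hp : p ∈ (extChartAt (𝓡 n) c).source) (hW : VDiffAt W p) :
    divergence o W p * volDensity n c p =
      fderiv ℝ (fun y => volDensity n c ((extChartAt (𝓡 n) c).symm y)) (extChartAt (𝓡 n) c p)
        (coordComp c p (W p)) +
      volDensity n c p * ∑ i, (fderiv ℝ (coordRep c W) (extChartAt (𝓡 n) c p)
        (EuclideanSpace.single i 1)) i := by
  set b := coordBasis c hp
  have hb := coordBasis_apply hp
  set L := b.constr ℝ fun i => nabla (𝓡 n) (coordField c (EuclideanSpace.single i 1)) p (W p)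
  set B := b.constr ℝ fun i => mlieBracket (𝓡 n) W (coordField c (EuclideanSpace.single i 1)) p
  have hV : ∀ i, VDiffAt (coordField c (EuclideanSpace.single i (1 : ℝ))) p :=
    fun i => mdifferentiableAt_coordField hp _
  have hL : ∀ i, L (b i) = nabla (𝓡 n) (coordField c (EuclideanSpace.single i 1)) p (W p) :=
    fun i => b.constr_basis ℝ _ i
  have hB : ∀ i, B (b i) = mlieBracket (𝓡 n) W (coordField c (EuclideanSpace.single i 1)) p :=
    fun i => b.constr_basis ℝ _ i
  have hLB : L - B = (nabla (𝓡 n) W p : TangentSpace (𝓡 n) p →ₗ[ℝ] TangentSpace (𝓡 n) p) := by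
    refine b.ext fun i => ?_
    rw [LinearMap.sub_apply, hL, hB, mlieBracket_eq_nabla hW (hV i), hb]
    simp
  have htB : LinearMap.trace ℝ _ B = -∑ i, (fderiv ℝ (coordRep c W) (extChartAt (𝓡 n) c p)
        (EuclideanSpace.single i 1)) i := by
    rw [LinearMap.trace_eq_matrix_trace ℝ b, Matrix.trace, ← Finset.sum_neg_distrib]
    refine Finset.sum_congr rfl fun i _ => ?_
    rw [Matrix.diag_apply, LinearMap.toMatrix_apply, hB, mlieBracket_swap_apply,
      mlieBracket_coordField hp hW, map_neg, Finsupp.neg_apply, coordBasis_repr]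
  obtain ⟨hm, hg⟩ := mvfderiv_gramDet hV b hb (W p) L hL
  have hpos := gramDet_coordField_pos hp
  have hd := (differentiableAt_comp_symm hp hm).hasFDerivAt
  have hinv := congrArg (fun q => gramDet fun i =>
    coordField c (EuclideanSpace.single (i : Fin n) (1 : ℝ)) q) ((extChartAt (𝓡 n) c).left_inv hp)
  have hd2 := hd.sqrt (hinv.trans_ne hpos.ne')
  rw [Function.comp_apply, hinv] at hd2
  have hfd : fderiv ℝ (fun y => volDensity n c ((extChartAt (𝓡 n) c).symm y))
      (extChartAt (𝓡 n) c p) (coordComp c p (W p)) = LinearMap.trace ℝ _ L * volDensity n c p := by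
    have h1 := congrArg (fun A => A (coordComp c p (W p))) hd2.fderiv
    refine Eq.trans h1 ?_
    rw [_root_.smul_apply, ← mvfderiv_apply_eq hp hm, hg]
    have hs : √(gramDet fun i => coordField c (EuclideanSpace.single (i : Fin n) (1 : ℝ)) p) ≠ 0 :=
      (Real.sqrt_pos.2 hpos).ne'
    have hss := Real.mul_self_sqrt hpos.le
    unfold volDensity
    rw [smul_eq_mul]
    field_simp
    rw [pow_two, hss]
    ring
  rw [divergence_eq_trace o hW, ← hLB, map_sub, htB, hfd]
  ring

end Density

/-! ### Integrals of derivatives of compactly supported functions. -/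

section EuclideanDivergence

variable {E : Type*} [NormedAddCommGroup E] [NormedSpace ℝ E] [FiniteDimensional ℝ E]
  [MeasurableSpace E] [BorelSpace E] {μ : Measure E} [μ.IsAddHaarMeasure]

/-- Integration by parts against the constant function `1`. -/
theorem integral_fderiv_eq_zero {F : E → ℝ} (hF : ContDiff ℝ 1 F) (hc : HasCompactSupport F)
    (v : E) : ∫ y, fderiv ℝ F y v ∂μ = 0 := by
  have h1 : Integrable (fun y => fderiv ℝ F y v) μ :=
    ((hF.continuous_fderiv (by simp)).clm_apply continuous_const).integrable_of_hasCompactSupport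
      (hc.fderiv_apply ℝ v)
  have h2 : Integrable F μ := hF.continuous.integrable_of_hasCompactSupport hc
  have h := integral_mul_fderiv_eq_neg_fderiv_mul_of_integrable (μ := μ) (f := fun _ : E => (1 : ℝ))
    (g := F) (v := v) (by simp) (by simpa using h1) (by simpa using h2) (by fun_prop)
    (fun x _ => hF.differentiable (by simp) x)
  simpa using h

/-- A coordinate expression carries information only on the chart target `U`. Its extension by zero
is `C¹` everywhere since `K` is compact inside the open set `U`. -/
theorem setIntegral_fderiv_eq_zero {g : E → ℝ} {U K : Set E} (hU : IsOpen U) (hK : IsCompact K)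
    (hKU : K ⊆ U) (hg : ∀ y ∈ U, ContDiffAt ℝ 1 g y) (h0 : ∀ y ∈ U, y ∉ K → g y = 0) (v : E) :
    IntegrableOn (fun y => fderiv ℝ g y v) U μ ∧ ∫ y in U, fderiv ℝ g y v ∂μ = 0 := by
  have hF0 : ∀ y ∉ K, U.indicator g y = 0 := fun y hy => by
    by_cases hyU : y ∈ U
    · rw [Set.indicator_of_mem hyU, h0 y hyU hy]
    · exact Set.indicator_of_notMem hyU g
  have hev : ∀ y ∈ U, U.indicator g =ᶠ[𝓝 y] g := fun y hy => by
    filter_upwards [hU.mem_nhds hy] with z hz using Set.indicator_of_mem hz g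
  have hev0 : ∀ y ∉ K, U.indicator g =ᶠ[𝓝 y] fun _ => 0 := fun y hy => by
    filter_upwards [hK.isClosed.isOpen_compl.mem_nhds hy] with z hz using hF0 z hz
  have hc : HasCompactSupport (U.indicator g) := HasCompactSupport.intro hK hF0
  have hF : ContDiff ℝ 1 (U.indicator g) := contDiff_iff_contDiffAt.2 fun y => by
    by_cases hy : y ∈ K
    · exact (hg y (hKU hy)).congr_of_eventuallyEq (hev y (hKU hy))
    · exact contDiffAt_const.congr_of_eventuallyEq (hev0 y hy)
  have hEq : Set.EqOn (fun y => fderiv ℝ g y v) (fun y => fderiv ℝ (U.indicator g) y v) U :=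
    fun y hy => by simp only [(hev y hy).fderiv_eq]
  constructor
  · have h1 : Integrable (fun y => fderiv ℝ (U.indicator g) y v) μ :=
      ((hF.continuous_fderiv (by simp)).clm_apply continuous_const).integrable_of_hasCompactSupport
        (hc.fderiv_apply ℝ v)
    exact h1.integrableOn.congr_fun hEq.symm hU.measurableSet
  · rw [setIntegral_congr_fun hU.measurableSet hEq, setIntegral_eq_integral_of_forall_compl_eq_zero]
    · exact integral_fderiv_eq_zero hF hc v
    · intro y hy
      rw [(hev0 y fun h => hy (hKU h)).fderiv_eq]
      simp

end EuclideanDivergence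

/-! ### Compact sets inside a chart. -/

section ChartImage

variable {n : ℕ} {M : Type*} [TopologicalSpace M] [ChartedSpace (EuclideanSpace ℝ (Fin n)) M]

theorem isCompact_image_extChartAt [CompactSpace M] {c : M} {T : Set M} (hT : IsClosed T)
    (hTc : T ⊆ (extChartAt (𝓡 n) c).source) : IsCompact (extChartAt (𝓡 n) c '' T) :=
  hT.isCompact.image_of_continuousOn ((continuousOn_extChartAt c).mono hTc)

theorem image_extChartAt_subset {c : M} {T : Set M}
    (hTc : T ⊆ (extChartAt (𝓡 n) c).source) : 
    extChartAt (𝓡 n) c '' T ⊆ (extChartAt (𝓡 n) c).target := by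
  rintro _ ⟨p, hp, rfl⟩
  exact (extChartAt (𝓡 n) c).map_source (hTc hp)

end ChartImage

/-! ### Integration over one chart and the local divergence theorem. -/

section LocalIntegral

variable {n : ℕ} {M : Type*} [TopologicalSpace M] [ChartedSpace (EuclideanSpace ℝ (Fin n)) M]
  [IsManifold (𝓡 n) ∞ M] [RiemannianBundle (fun x : M => TangentSpace (𝓡 n) x)]

variable (n) in
/-- The integral of a function over the domain of the chart around `c`. -/
def chartIntegral (c : M) (h : M → ℝ) : ℝ :=
  ∫ y in (extChartAt (𝓡 n) c).target, h ((extChartAt (𝓡 n) c).symm y) *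
    volDensity n c ((extChartAt (𝓡 n) c).symm y)

/-- The sign of the volume form times its value on the coordinate frame is the density, so the
orientation disappears from the integral. -/
theorem integralVol_eq_finsum [CompactSpace M] [T2Space M] (o : ManifoldOrientation n M)
    (f : M → ℝ) :
    integralVol o f = ∑ᶠ c : M, chartIntegral n c (fun p => chartPartition n M c p * f p) := by
  unfold integralVol integralForm chartIntegral
  refine finsum_congr fun c => setIntegral_congr_fun
    (isOpen_extChartAt_target c).measurableSet fun y hy => ?_
  simp only [AlternatingMap.smul_apply, smul_eq_mul]
  rw [← abs_volForm_coordFrame o hy, ← sign_mul_abs_self (volForm o _ (coordFrame c y))]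
  generalize volForm o ((extChartAt (𝓡 n) c).symm y) (coordFrame c y) = m
  rcases lt_trichotomy m 0 with h | rfl | h
  · simp [Real.sign_of_neg h, abs_of_neg h]
    ring
  · simp
  · simp [Real.sign_of_pos h, abs_of_pos h]
    ring

/-- Both integrals live on the overlap of the charts, outside of which `h` vanishes. There the
Jacobian of the transition map accounts for the ratio of the densities. -/
theorem chartIntegral_congr_chart {c d : M} {h : M → ℝ}
    (hc : ∀ p, h p ≠ 0 → p ∈ (extChartAt (𝓡 n) c).source)
    (hd : ∀ p, h p ≠ 0 → p ∈ (extChartAt (𝓡 n) d).source) :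
    chartIntegral n c h = chartIntegral n d h := by
  set ec := extChartAt (𝓡 n) c
  set ed := extChartAt (𝓡 n) d
  set A := ec.target ∩ ec.symm ⁻¹' ed.source with hA
  set B := ed.target ∩ ed.symm ⁻¹' ec.source with hB
  have hAo : IsOpen A := (continuousOn_extChartAt_symm c).isOpen_inter_preimage
    (isOpen_extChartAt_target c) (isOpen_extChartAt_source d)
  have h1 : chartIntegral n c h = ∫ y in A, h (ec.symm y) * volDensity n c (ec.symm y) := by
    refine setIntegral_eq_of_subset_of_forall_sdiff_eq_zero
      (isOpen_extChartAt_target c).measurableSet Set.inter_subset_left fun y hy => ?_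
    have : h (ec.symm y) = 0 := by
      by_contra h0
      exact hy.2 ⟨hy.1, hd _ h0⟩
    exact mul_eq_zero_of_left this _
  have h2 : chartIntegral n d h = ∫ y in B, h (ed.symm y) * volDensity n d (ed.symm y) := by
    refine setIntegral_eq_of_subset_of_forall_sdiff_eq_zero
      (isOpen_extChartAt_target d).measurableSet Set.inter_subset_left fun y hy => ?_
    have : h (ed.symm y) = 0 := by
      by_contra h0
      exact hy.2 ⟨hy.1, hc _ h0⟩
    exact mul_eq_zero_of_left this _
  have himg : (ed ∘ ec.symm) '' A = B := by
    ext z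
    constructor
    · rintro ⟨y, ⟨hy1, hy2⟩, rfl⟩
      refine ⟨ed.map_source hy2, ?_⟩
      simp only [Set.mem_preimage, Function.comp_apply, ed.left_inv hy2]
      exact ec.map_target hy1
    · rintro ⟨hz1, hz2⟩
      refine ⟨ec (ed.symm z), ⟨ec.map_source hz2, ?_⟩, ?_⟩
      · simp only [Set.mem_preimage, ec.left_inv hz2]
        exact ed.map_target hz1
      · simp only [Function.comp_apply, ec.left_inv hz2, ed.right_inv hz1]
  have hinj : Set.InjOn (ed ∘ ec.symm) A := by
    rintro y ⟨hy1, hy2⟩ z ⟨hz1, hz2⟩ hyz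
    exact ec.symm.injOn hy1 hz1 (ed.injOn hy2 hz2 hyz)
  have hderiv : ∀ y ∈ A, HasFDerivWithinAt (ed ∘ ec.symm) (fderiv ℝ (ed ∘ ec.symm) y) A y := by
    rintro y ⟨hy1, hy2⟩
    have hm := mdifferentiableAt_extChartAt (I := 𝓡 n) (x := d) (y := ec.symm y)
      (by rw [← extChartAt_source (𝓡 n)]; exact hy2)
    have h3 := differentiableAt_comp_symm (ec.map_target hy1) hm
    rw [ec.right_inv hy1] at h3
    exact h3.hasFDerivAt.hasFDerivWithinAt
  rw [h1, h2, ← himg, integral_image_eq_integral_abs_det_fderiv_smul _ hAo.measurableSet hderiv hinj]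
  refine setIntegral_congr_fun hAo.measurableSet ?_
  rintro y ⟨hy1, hy2⟩
  have h4 := volDensity_eq_abs_det_mul (ec.map_target hy1) hy2
  simp only [Function.comp_apply, smul_eq_mul, ed.left_inv hy2]
  rw [h4, ec.right_inv hy1]
  simp only [ec, ed]
  ring

variable [IsContMDiffRiemannianBundle (𝓡 n) ∞ (EuclideanSpace ℝ (Fin n))
    (fun x : M => TangentSpace (𝓡 n) x)]

theorem integrableOn_chart [CompactSpace M] {c : M} {h : M → ℝ} (hh : Continuous h) {T : Set M} (hT : IsClosed T)
    (hTc : T ⊆ (extChartAt (𝓡 n) c).source) (h0 : ∀ p ∉ T, h p = 0) :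
    IntegrableOn (fun y => h ((extChartAt (𝓡 n) c).symm y) *
      volDensity n c ((extChartAt (𝓡 n) c).symm y)) (extChartAt (𝓡 n) c).target := by
  have hc : ContinuousOn (fun y => h ((extChartAt (𝓡 n) c).symm y) *
      volDensity n c ((extChartAt (𝓡 n) c).symm y)) (extChartAt (𝓡 n) c).target := by
    refine (hh.comp_continuousOn (continuousOn_extChartAt_symm c)).mul fun y hy => ?_
    have h1 := contDiffAt_volDensity (n := n) ((extChartAt (𝓡 n) c).map_target hy)
    rw [(extChartAt (𝓡 n) c).right_inv hy] at h1
    exact h1.continuousAt.continuousWithinAt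
  have hK := isCompact_image_extChartAt hT hTc
  refine IntegrableOn.of_forall_sdiff_eq_zero
    ((hc.mono (image_extChartAt_subset hTc)).integrableOn_compact hK)
    (isOpen_extChartAt_target c).measurableSet fun y hy => ?_
  rw [h0, zero_mul]
  exact fun hyT => hy.2 ⟨_, hyT, (extChartAt (𝓡 n) c).right_inv hy.1⟩

theorem contDiffAt_volDensity_symm {c : M} {y : EuclideanSpace ℝ (Fin n)}
    (hy : y ∈ (extChartAt (𝓡 n) c).target) :
    ContDiffAt ℝ ∞ (fun y => volDensity n c ((extChartAt (𝓡 n) c).symm y)) y := by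
  have h1 := contDiffAt_volDensity (n := n) ((extChartAt (𝓡 n) c).map_target hy)
  rwa [(extChartAt (𝓡 n) c).right_inv hy] at h1

theorem contDiffAt_volDensity_mul_coordRep {c : M} {y : EuclideanSpace ℝ (Fin n)}
    (hy : y ∈ (extChartAt (𝓡 n) c).target) (W : VField n M) (i : Fin n) :
    ContDiffAt ℝ ∞ (fun z => volDensity n c ((extChartAt (𝓡 n) c).symm z) * coordRep c W z i) y :=
  (contDiffAt_volDensity_symm hy).mul ((EuclideanSpace.proj (𝕜 := ℝ) i).contDiff.contDiffAt.comp y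
    (contDiffAt_coordRep (k := ⊤) hy (W.contMDiff _)))

/-- The product rule puts `divergence_mul_volDensity` into the form `∑ ∂_i(√g W^i)`, whose terms
integrate to zero one by one. -/
theorem divergence_mul_volDensity_eq_sum (o : ManifoldOrientation n M) {c : M}
    {y : EuclideanSpace ℝ (Fin n)} (hy : y ∈ (extChartAt (𝓡 n) c).target) (W : VField n M) :
    divergence o W ((extChartAt (𝓡 n) c).symm y) * volDensity n c ((extChartAt (𝓡 n) c).symm y) =
      ∑ i, fderiv ℝ (fun z => volDensity n c ((extChartAt (𝓡 n) c).symm z) * coordRep c W z i) y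
        (EuclideanSpace.single i 1) := by
  have h1 := divergence_mul_volDensity o ((extChartAt (𝓡 n) c).map_target hy) (W := W)
    W.mdifferentiableAt
  rw [(extChartAt (𝓡 n) c).right_inv hy] at h1
  refine h1.trans ?_
  have h2 : ∀ i : Fin n, fderiv ℝ (fun z => volDensity n c ((extChartAt (𝓡 n) c).symm z) *
        coordRep c W z i) y (EuclideanSpace.single i 1) =
      volDensity n c ((extChartAt (𝓡 n) c).symm y) *
        (fderiv ℝ (coordRep c W) y (EuclideanSpace.single i 1)) i +
      coordRep c W y i * fderiv ℝ (fun y => volDensity n c ((extChartAt (𝓡 n) c).symm y)) y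
        (EuclideanSpace.single i 1) := by
    intro i
    have hd1 := (contDiffAt_volDensity_symm hy).differentiableAt (by simp)
    have hd2 := (contDiffAt_coordRep (k := ⊤) hy (W.contMDiff _)).differentiableAt (by simp)
    have h3 : HasFDerivAt (fun z => coordRep c W z i)
      ((EuclideanSpace.proj (𝕜 := ℝ) i).comp (fderiv ℝ (coordRep c W) y)) y :=
      (EuclideanSpace.proj (𝕜 := ℝ) i).hasFDerivAt.comp y hd2.hasFDerivAt
    exact congrArg (fun A => A (EuclideanSpace.single i 1)) (hd1.hasFDerivAt.fun_mul h3).fderiv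
  simp only [h2]
  rw [Finset.sum_add_distrib, ← Finset.mul_sum, add_comm]
  congr 1
  have h4 : coordRep c W y = ∑ i, coordRep c W y i • EuclideanSpace.single i (1 : ℝ) := by
    ext j
    simp [Finset.sum_apply, Pi.single_apply]
  refine (congrArg (fderiv ℝ (fun y => volDensity n c ((extChartAt (𝓡 n) c).symm y)) y) h4).trans ?_
  rw [map_sum]
  exact Finset.sum_congr rfl fun i _ => by rw [map_smul, smul_eq_mul]

theorem chartIntegral_divergence_eq_zero [CompactSpace M] (o : ManifoldOrientation n M) {c : M}
    (W : VField n M) {T : Set M} (hT : IsClosed T) (hTc : T ⊆ (extChartAt (𝓡 n) c).source)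
    (h0 : ∀ p ∉ T, W p = 0) : chartIntegral n c (divergence o W) = 0 := by
  have hK := isCompact_image_extChartAt (n := n) hT hTc
  have key : ∀ i : Fin n, _ := fun i => setIntegral_fderiv_eq_zero (μ := volume)
    (g := fun z => volDensity n c ((extChartAt (𝓡 n) c).symm z) * coordRep c W z i)
    (isOpen_extChartAt_target c) hK (image_extChartAt_subset hTc)
    (fun y hy => (contDiffAt_volDensity_mul_coordRep hy W i).of_le (by exact_mod_cast le_top))
    (fun y hy hyK => by
      have h1 : W ((extChartAt (𝓡 n) c).symm y) = 0 :=
        h0 _ fun h => hyK ⟨_, h, (extChartAt (𝓡 n) c).right_inv hy⟩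
      have h2 : coordRep c W y = 0 := (congrArg (coordComp c _) h1).trans (map_zero _)
      simp [h2]) (EuclideanSpace.single i 1)
  unfold chartIntegral
  rw [setIntegral_congr_fun (isOpen_extChartAt_target c).measurableSet
    fun y hy => divergence_mul_volDensity_eq_sum o hy W, integral_finsetSum _ fun i _ => (key i).1]
  exact Finset.sum_eq_zero fun i _ => (key i).2

/-- The definition uses an orthonormal basis chosen separately at each point, so continuity is read
off from the coordinate formula divided by the positive density. -/
theorem continuous_divergence (o : ManifoldOrientation n M) (W : VField n M) :
    Continuous (divergence o W) := by
  refine continuous_iff_continuousAt.2 fun p => ?_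
  have hp := mem_extChartAt_source (I := 𝓡 n) p
  have hy := (extChartAt (𝓡 n) p).map_source hp
  have h1 : ContinuousAt (fun y => (∑ i, fderiv ℝ (fun z => volDensity n p
      ((extChartAt (𝓡 n) p).symm z) * coordRep p W z i) y (EuclideanSpace.single i 1)) /
      volDensity n p ((extChartAt (𝓡 n) p).symm y)) (extChartAt (𝓡 n) p p) := by
    refine ContinuousAt.div ?_ (contDiffAt_volDensity_symm hy).continuousAt
      (volDensity_pos ((extChartAt (𝓡 n) p).map_target hy)).ne'
    refine tendsto_finsetSum _ fun i _ => ?_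
    exact (((contDiffAt_volDensity_mul_coordRep hy W i).fderiv_right (m := 0)
      (by simp)).continuousAt).clm_apply continuousAt_const
  have h2 := ContinuousAt.comp (f := extChartAt (𝓡 n) p) h1 (continuousAt_extChartAt p)
  refine h2.congr ?_
  filter_upwards [extChartAt_source_mem_nhds (I := 𝓡 n) p] with q hq
  have h3 := divergence_mul_volDensity_eq_sum o ((extChartAt (𝓡 n) p).map_source hq) W
  simp only [Function.comp_apply]
  rw [← h3, mul_div_cancel_right₀ _ (volDensity_pos ((extChartAt (𝓡 n) p).map_target
    ((extChartAt (𝓡 n) p).map_source hq))).ne', (extChartAt (𝓡 n) p).left_inv hq]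

end LocalIntegral

/-! ### Additivity and the product rule for the divergence. -/

section DivergenceAlgebra

variable {n : ℕ} {M : Type*} [TopologicalSpace M] [ChartedSpace (EuclideanSpace ℝ (Fin n)) M]
  [IsManifold (𝓡 n) ∞ M]

/-- The product of a smooth function and a smooth vector field. -/
def smulField (f : M → ℝ) (hf : ContMDiff (𝓡 n) 𝓘(ℝ, ℝ) ∞ f) (W : VField n M) : VField n M :=
  ⟨fun p => f p • W p, hf.smul_section W.contMDiff⟩

variable [RiemannianBundle (fun x : M => TangentSpace (𝓡 n) x)]
  [IsContMDiffRiemannianBundle (𝓡 n) ∞ (EuclideanSpace ℝ (Fin n))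
    (fun x : M => TangentSpace (𝓡 n) x)]

theorem divergence_add (o : ManifoldOrientation n M) (V W : VField n M) (x : M) :
    divergence o (V + W : VField n M) x = divergence o V x + divergence o W x := by
  rw [divergence_eq_trace o V.mdifferentiableAt, divergence_eq_trace o W.mdifferentiableAt,
    divergence_eq_trace o (V + W).mdifferentiableAt, ← map_add]
  have h := (leviCivita (𝓡 n) M).isCovariantDerivativeOnUniv.add (x := x)
    V.mdifferentiableAt W.mdifferentiableAt
  exact congrArg (fun A : TangentSpace (𝓡 n) x →L[ℝ] TangentSpace (𝓡 n) x =>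
    LinearMap.trace ℝ (TangentSpace (𝓡 n) x) A.toLinearMap) h

theorem divergence_sum (o : ManifoldOrientation n M) {ι : Type*} (S : Finset ι) (W : ι → VField n M) (x : M) :
    divergence o (∑ i ∈ S, W i : VField n M) x = ∑ i ∈ S, divergence o (W i) x :=
  map_sum (AddMonoidHom.mk' (fun V : VField n M => divergence o V x)
    fun V W => divergence_add o V W x) W S

/-- `∇(fW) = f ∇W + df ⊗ W`, and the rank-one term has trace `df(W)`. -/
theorem divergence_smulField (o : ManifoldOrientation n M) (f : M → ℝ) (hf : ContMDiff (𝓡 n) 𝓘(ℝ, ℝ) ∞ f) (W : VField n M)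
    (x : M) : divergence o (smulField f hf W) x =
      f x * divergence o W x + mvfderiv (𝓡 n) f x (W x) := by
  rw [divergence_eq_trace o W.mdifferentiableAt,
    divergence_eq_trace o (smulField f hf W).mdifferentiableAt]
  have h := (leviCivita (𝓡 n) M).isCovariantDerivativeOnUniv.leibniz (x := x)
    W.mdifferentiableAt ((hf x).mdifferentiableAt (by simp))
  refine (congrArg (fun A : TangentSpace (𝓡 n) x →L[ℝ] TangentSpace (𝓡 n) x =>
    LinearMap.trace ℝ (TangentSpace (𝓡 n) x) A.toLinearMap) h).trans ?_
  change LinearMap.trace ℝ (TangentSpace (𝓡 n) x) (f x • (nabla (𝓡 n) W x).toLinearMap +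
    (mvfderiv (𝓡 n) f x).toLinearMap.smulRight (W x)) = _
  rw [map_add, map_smul, LinearMap.trace_smulRight, smul_eq_mul]
  rfl

theorem divergence_smulField_eq_zero (o : ManifoldOrientation n M) {f : M → ℝ} (hf : ContMDiff (𝓡 n) 𝓘(ℝ, ℝ) ∞ f)
    (W : VField n M) {x : M} (hx : x ∉ tsupport f) : divergence o (smulField f hf W) x = 0 := by
  have h1 : f =ᶠ[𝓝 x] fun _ => 0 := notMem_tsupport_iff_eventuallyEq.1 hx
  rw [divergence_smulField, h1.mvfderiv_eq, h1.self_of_nhds, zero_mul, zero_add, mvfderiv_const]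
  rfl

theorem chartIntegral_finset_sum [CompactSpace M] {ι : Type*} {c : M} (S : Finset ι) {h : ι → M → ℝ}
    (hh : ∀ i, Continuous (h i)) {T : Set M} (hT : IsClosed T)
    (hTc : T ⊆ (extChartAt (𝓡 n) c).source) (h0 : ∀ i, ∀ p ∉ T, h i p = 0) :
    chartIntegral n c (fun p => ∑ i ∈ S, h i p) = ∑ i ∈ S, chartIntegral n c (h i) := by
  unfold chartIntegral
  rw [← integral_finsetSum _ fun i _ => integrableOn_chart (hh i) hT hTc (h0 i)]
  simp only [Finset.sum_mul]

end DivergenceAlgebra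

/-! ### The divergence theorem on the closed manifold, and the adjoint formula. -/

section DivergenceTheorem

variable {n : ℕ} {M : Type*} [TopologicalSpace M] [ChartedSpace (EuclideanSpace ℝ (Fin n)) M]
  [IsManifold (𝓡 n) ∞ M] [CompactSpace M] [T2Space M]

theorem tsupport_chartPartition_subset (c : M) :
    tsupport (chartPartition n M c) ⊆ (extChartAt (𝓡 n) c).source := by
  rw [extChartAt_source]
  exact (SmoothPartitionOfUnity.exists_isSubordinate_chartAt_source (𝓡 n) M).choose_spec c

theorem continuous_chartPartition (c : M) : Continuous (chartPartition n M c) :=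
  (chartPartition n M c).contMDiff.continuous

/-- On a compact space a locally finite family has only finitely many nonzero members, so one finite
index set serves for all points. -/
theorem exists_finset_chartPartition : ∃ S : Finset M,
    (∀ c ∉ S, ∀ p, chartPartition n M c p = 0) ∧ ∀ p, ∑ c ∈ S, chartPartition n M c p = 1 := by
  have hfin := (chartPartition n M).locallyFinite.finite_nonempty_of_compact
  have h0 : ∀ c ∉ hfin.toFinset, ∀ p, chartPartition n M c p = 0 := by
    intro c hc p
    by_contra h
    exact hc (hfin.mem_toFinset.2 ⟨p, h⟩)
  refine ⟨hfin.toFinset, h0, fun p => ?_⟩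
  rw [← (chartPartition n M).sum_eq_one (Set.mem_univ p)]
  refine (finsum_eq_sum_of_support_subset _ fun c hc => ?_).symm
  by_contra h
  exact hc (h0 c h p)

variable [RiemannianBundle (fun x : M => TangentSpace (𝓡 n) x)] (o : ManifoldOrientation n M)

theorem integralVol_eq_sum {S : Finset M} (hS : ∀ c ∉ S, ∀ p, chartPartition n M c p = 0)
    (f : M → ℝ) :
    integralVol o f = ∑ c ∈ S, chartIntegral n c (fun p => chartPartition n M c p * f p) := by
  rw [integralVol_eq_finsum]
  refine finsum_eq_sum_of_support_subset _ fun c hc => ?_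
  by_contra h
  refine hc ?_
  simp [chartIntegral, hS c h]

theorem integralVol_const_mul (r : ℝ) (f : M → ℝ) :
    integralVol o (fun p => r * f p) = r * integralVol o f := by
  obtain ⟨S, hS, -⟩ := exists_finset_chartPartition (n := n) (M := M)
  simp only [integralVol_eq_sum o hS, Finset.mul_sum, chartIntegral, ← integral_const_mul]
  refine Finset.sum_congr rfl fun c _ => integral_congr_ae (.of_forall fun y => ?_)
  ring

variable [IsContMDiffRiemannianBundle (𝓡 n) ∞ (EuclideanSpace ℝ (Fin n))
    (fun x : M => TangentSpace (𝓡 n) x)]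

theorem integralVol_add {f g : M → ℝ} (hf : Continuous f) (hg : Continuous g) :
    integralVol o (fun p => f p + g p) = integralVol o f + integralVol o g := by
  obtain ⟨S, hS, -⟩ := exists_finset_chartPartition (n := n) (M := M)
  simp only [integralVol_eq_sum o hS, ← Finset.sum_add_distrib]
  refine Finset.sum_congr rfl fun c _ => ?_
  have h := chartIntegral_finset_sum (n := n) (c := c) Finset.univ
    (h := ![fun p => chartPartition n M c p * f p, fun p => chartPartition n M c p * g p])
    (Fin.forall_fin_two.2 ⟨(continuous_chartPartition c).mul hf,
      (continuous_chartPartition c).mul hg⟩) (isClosed_tsupport (chartPartition n M c))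
    (tsupport_chartPartition_subset c)
    (Fin.forall_fin_two.2 ⟨fun p hp => mul_eq_zero_of_left (image_eq_zero_of_notMem_tsupport hp) _,
      fun p hp => mul_eq_zero_of_left (image_eq_zero_of_notMem_tsupport hp) _⟩)
  simpa [Fin.sum_univ_two, mul_add] using h

/-- Each `ρ_d W` is supported in one chart, where the local theorem applies. The weights `ρ_c` in
the definition of the integral stand outside the divergence, so they must be summed to `1` within
chart `d` beforehand. -/
theorem integralVol_divergence (W : VField n M) : integralVol o (divergence o W) = 0 := by
  obtain ⟨S, hS, hS1⟩ := exists_finset_chartPartition (n := n) (M := M)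
  have hρ : ∀ d, ContMDiff (𝓡 n) 𝓘(ℝ, ℝ) ∞ (chartPartition n M d) := fun d =>
    (chartPartition n M d).contMDiff
  set D : M → M → ℝ := fun d => divergence o (smulField (chartPartition n M d) (hρ d) W)
  have hD : ∀ d, Continuous (D d) := fun d => continuous_divergence o _
  have hD0 : ∀ d, ∀ p ∉ tsupport (chartPartition n M d), D d p = 0 := fun d p hp =>
    divergence_smulField_eq_zero o (hρ d) W hp
  have hsum : ∀ p, divergence o W p = ∑ d ∈ S, D d p := by
    intro p
    have h : W = ∑ d ∈ S, smulField (chartPartition n M d) (hρ d) W := by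
      ext1 q
      have h1 : (∑ d ∈ S, smulField (chartPartition n M d) (hρ d) W) q =
          ∑ d ∈ S, chartPartition n M d q • W q :=
        map_sum (AddMonoidHom.mk' (fun V : VField n M => V q) fun _ _ => rfl) _ S
      rw [h1, ← Finset.sum_smul, hS1, one_smul]
    conv_lhs => rw [h]
    exact divergence_sum o S _ p
  have hne : ∀ c p, chartPartition n M c p ≠ 0 → p ∈ tsupport (chartPartition n M c) :=
    fun c p h => subset_tsupport _ h
  calc integralVol o (divergence o W)
      = ∑ c ∈ S, chartIntegral n c (fun p => ∑ d ∈ S, chartPartition n M c p * D d p) := by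
        simp only [integralVol_eq_sum o hS, hsum, Finset.mul_sum]
    _ = ∑ c ∈ S, ∑ d ∈ S, chartIntegral n c (fun p => chartPartition n M c p * D d p) := by
        refine Finset.sum_congr rfl fun c _ => chartIntegral_finset_sum S
          (fun d => (continuous_chartPartition c).mul (hD d))
          (isClosed_tsupport (chartPartition n M c)) (tsupport_chartPartition_subset c)
          fun d p hp => mul_eq_zero_of_left (image_eq_zero_of_notMem_tsupport hp) _
    -- The integrand is supported in both charts, so its integral may be computed in the chart of
    -- `d` instead of that of `c`.
    _ = ∑ d ∈ S, ∑ c ∈ S, chartIntegral n d (fun p => chartPartition n M c p * D d p) := by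
        rw [Finset.sum_comm]
        refine Finset.sum_congr rfl fun d _ => Finset.sum_congr rfl fun c _ =>
          chartIntegral_congr_chart (fun p hp => ?_) fun p hp => ?_
        · exact tsupport_chartPartition_subset c (hne c p (left_ne_zero_of_mul hp))
        · refine tsupport_chartPartition_subset d ?_
          by_contra h
          exact right_ne_zero_of_mul hp (hD0 d p h)
    _ = ∑ d ∈ S, chartIntegral n d (fun p => ∑ c ∈ S, chartPartition n M c p * D d p) := by
        refine Finset.sum_congr rfl fun d _ => (chartIntegral_finset_sum S
          (fun c => (continuous_chartPartition c).mul (hD d))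
          (isClosed_tsupport (chartPartition n M d)) (tsupport_chartPartition_subset d)
          fun c p hp => mul_eq_zero_of_right _ (hD0 d p hp)).symm
    _ = ∑ d ∈ S, chartIntegral n d (D d) := by
        simp only [← Finset.sum_mul, hS1, one_mul]
    _ = 0 := Finset.sum_eq_zero fun d _ => chartIntegral_divergence_eq_zero o _
        (isClosed_tsupport (chartPartition n M d)) (tsupport_chartPartition_subset d)
        fun p hp => by
          change chartPartition n M d p • W p = 0
          rw [image_eq_zero_of_notMem_tsupport hp, zero_smul]

/-- The two integrands, after the adjoint is moved over, differ pointwise by `div(g(X,X) Y)`, which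
integrates to zero. -/
theorem integralVol_adjoint_eq (𝔤 : LieSubalgebra ℝ (VField n M)) (X Y : 𝔤) (A : 𝔤 →ₗ[ℝ] 𝔤)
    (hA : IsAdjointOfAd o 𝔤 X A) :
    2 * integralVol o (fun x => metricTensor (𝓡 n) x ((A X).1 x) (Y.1 x)) =
      integralVol o (fun x => symDivTensor o Y.1 x (X.1 x) (X.1 x)) := by
  have h1 : integralVol o (fun x => metricTensor (𝓡 n) x ((A X).1 x) (Y.1 x)) =
    integralVol o (fun x => metricTensor (𝓡 n) x (X.1 x) (mlieBracket (𝓡 n) X.1 Y.1 x)) := hA X Y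
  have hi : ∀ V W : VField n M, ContMDiff (𝓡 n) 𝓘(ℝ, ℝ) ∞ fun x => (inner ℝ (V x) (W x) : ℝ) :=
    fun V W => ContMDiff.inner_bundle (IB := 𝓡 n) (F := EuclideanSpace ℝ (Fin n))
      (E := fun x : M => TangentSpace (𝓡 n) x) V.contMDiff W.contMDiff
  have h2 : ∀ x, symDivTensor o Y.1 x (X.1 x) (X.1 x) =
      2 * metricTensor (𝓡 n) x (X.1 x) (mlieBracket (𝓡 n) X.1 Y.1 x) +
        divergence o (smulField _ (hi X.1 X.1) Y.1) x := by
    intro x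
    have hX : VDiffAt X.1 x := X.1.mdifferentiableAt
    have hY : VDiffAt Y.1 x := Y.1.mdifferentiableAt
    rw [divergence_smulField, mvfderiv_inner hX hX, mlieBracket_eq_nabla hX hY]
    change nablaFormSym (𝓡 n) (flat (𝓡 n) Y.1) x (X.1 x) (X.1 x) +
      divergence o Y.1 x * inner ℝ (X.1 x) (X.1 x) = 2 * inner ℝ (X.1 x) _ + _
    rw [nablaFormSym_flat_apply hY, inner_sub_right, real_inner_comm (X.1 x) (nabla _ _ x _),
      real_inner_comm (X.1 x) (nabla _ _ x _)]
    ring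
  have hc : Continuous fun x => 2 * metricTensor (𝓡 n) x (X.1 x)
      (mlieBracket (𝓡 n) X.1 Y.1 x) := continuous_const.mul (hi X.1 ⁅X.1, Y.1⁆).continuous
  simp only [h2]
  rw [integralVol_add o hc (continuous_divergence o _), integralVol_divergence, add_zero,
    integralVol_const_mul, h1]

end DivergenceTheorem

/-! ### Smoothness of composition operators on spaces of continuous curves. -/

section Superposition

universe u

variable {K : Type*} [TopologicalSpace K] [CompactSpace K]
  {E F : Type u} [NormedAddCommGroup E] [NormedSpace ℝ E] [NormedAddCommGroup F] [NormedSpace ℝ F]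

variable (K) in
/-- A bounded bilinear map, applied pointwise to continuous maps. -/
def pointwiseBilinear {G : Type u} [NormedAddCommGroup G] [NormedSpace ℝ G] (B : G →L[ℝ] E →L[ℝ] F) :
    C(K, G) →L[ℝ] C(K, E) →L[ℝ] C(K, F) :=
  LinearMap.mkContinuous₂
    (LinearMap.mk₂ ℝ (fun (A : C(K, G)) (η : C(K, E)) => (⟨fun t => B (A t) (η t),
        (B.continuous.comp A.continuous).clm_apply η.continuous⟩ : C(K, F)))
      (fun _ _ _ => by ext; simp) (fun _ _ _ => by ext; simp) (fun _ _ _ => by ext; simp)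
      (fun _ _ _ => by ext; simp)) ‖B‖ fun A η => by
    rw [ContinuousMap.norm_le _ (by positivity)]
    intro t
    refine (B.le_opNorm₂ (A t) (η t)).trans ?_
    gcongr
    · exact A.norm_coe_le_norm t
    · exact η.norm_coe_le_norm t

set_option synthInstance.maxHeartbeats 400000 in
variable (K E F) in
/-- Pointwise application of a continuous family of operators, as a bounded bilinear map. -/
def pointwiseApply : C(K, E →L[ℝ] F) →L[ℝ] C(K, E) →L[ℝ] C(K, F) :=
  pointwiseBilinear K (ContinuousLinearMap.id ℝ (E →L[ℝ] F))

-- Uniform continuity of `f'` makes the mean value estimate uniform in `t`, hence valid in the sup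
-- norm.
set_option synthInstance.maxHeartbeats 400000 in
theorem hasFDerivAt_superposition (f : C(E, F)) (f' : C(E, E →L[ℝ] F)) (hu : UniformContinuous f')
    (hf : ∀ x, HasFDerivAt f (f' x) x) (γ : C(K, E)) :
    HasFDerivAt (fun γ : C(K, E) => f.comp γ) (pointwiseApply K E F (f'.comp γ)) γ := by
  rw [hasFDerivAt_iff_isLittleO_nhds_zero, Asymptotics.isLittleO_iff]
  intro ε hε
  obtain ⟨δ, hδ, hδ'⟩ := Metric.uniformContinuous_iff.1 hu ε hε
  filter_upwards [Metric.ball_mem_nhds (0 : C(K, E)) hδ] with η hη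
  rw [mem_ball_zero_iff] at hη
  rw [ContinuousMap.norm_le _ (by positivity)]
  intro t
  have ht : ‖η t‖ < δ := (η.norm_coe_le_norm t).trans_lt hη
  have h1 := (convex_ball (γ t) δ).norm_image_sub_le_of_norm_hasFDerivWithin_le' (f := f) (f' := f')
    (φ := f' (γ t)) (C := ε) (x := γ t) (y := γ t + η t) (fun x _ => (hf x).hasFDerivWithinAt)
    (fun x hx => by
      rw [← dist_eq_norm]
      exact (hδ' (Metric.mem_ball.1 hx)).le) (Metric.mem_ball_self hδ) (by simpa using ht)
  rw [add_sub_cancel_left] at h1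
  exact h1.trans (mul_le_mul_of_nonneg_left (η.norm_coe_le_norm t) hε.le)

-- The derivative is the bounded operator `pointwiseApply` after superposition with `fderiv ℝ f`,
-- which is again smooth with compact support. The target `F` varies in the induction, and keeping
-- `E` and `F` in one universe lets `E →L[ℝ] F` take its place.
set_option synthInstance.maxHeartbeats 400000 in
theorem contDiff_superposition (k : ℕ) : ∀ {F : Type u} [NormedAddCommGroup F] [NormedSpace ℝ F]
    (f : C(E, F)), ContDiff ℝ ∞ f → HasCompactSupport f →
    ContDiff ℝ k (fun γ : C(K, E) => f.comp γ) := by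
  induction k with
  | zero => exact fun f _ _ => contDiff_zero.2 (ContinuousMap.continuous_postcomp f)
  | succ k ih =>
    intro F _ _ f hf hc
    rw [contDiff_infty_iff_fderiv] at hf
    let f' : C(E, E →L[ℝ] F) := ⟨fderiv ℝ f, hf.2.continuous⟩
    have hc' : HasCompactSupport f' := hc.fderiv ℝ
    have h1 := ih f' hf.2 hc'
    have h2 : ContDiff ℝ k (pointwiseApply K E F) := ContinuousLinearMap.contDiff _
    refine contDiff_succ_iff_hasFDerivAt.2 ⟨fun γ => pointwiseApply K E F (f'.comp γ),
      h2.comp h1, hasFDerivAt_superposition f f'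
        (hc'.uniformContinuous_of_continuous f'.continuous) fun x => (hf.1 x).hasFDerivAt⟩

end Superposition

/-! ### Local flows in a Banach space by the implicit function theorem. -/

section LocalFlow

universe u

variable {E : Type u} [NormedAddCommGroup E]

theorem continuous_extend_Icc (γ : C(Set.Icc (-2 : ℝ) 2, E)) :
    Continuous fun s => γ (Set.projIcc (-2) 2 (by norm_num) s) :=
  γ.continuous.comp continuous_projIcc

variable [NormedSpace ℝ E] [CompleteSpace E]

variable (E) in
/-- The primitive vanishing at `0` of a curve on `[-2, 2]`, as a bounded operator. -/
def primitiveCLM : C(Set.Icc (-2 : ℝ) 2, E) →L[ℝ] C(Set.Icc (-2 : ℝ) 2, E) :=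
  LinearMap.mkContinuous
    { toFun := fun γ => ⟨fun s => ∫ t in (0 : ℝ)..s, γ (Set.projIcc (-2) 2 (by norm_num) t),
        (intervalIntegral.continuous_primitive
          (fun a b => (continuous_extend_Icc γ).intervalIntegrable a b) 0).comp
          continuous_subtype_val⟩
      map_add' := fun γ η => by
        ext s
        exact intervalIntegral.integral_add ((continuous_extend_Icc γ).intervalIntegrable _ _)
          ((continuous_extend_Icc η).intervalIntegrable _ _)
      map_smul' := fun r γ => by
        ext s
        exact intervalIntegral.integral_smul r _ } 2 fun γ => by
    rw [ContinuousMap.norm_le _ (by positivity)]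
    intro s
    refine (intervalIntegral.norm_integral_le_of_norm_le_const
      fun t _ => γ.norm_coe_le_norm _).trans ?_
    rw [mul_comm, sub_zero]
    exact mul_le_mul_of_nonneg_right (abs_le.2 s.2) (norm_nonneg _)

/-- For `q = (τ, y)`, the curve `ψ q` solves the rescaled equation `γ' = τ f(γ)` with `γ(0) = y`, so
`ψ q 1` is the time-`τ` flow. Time has become a parameter, and parameters are what the implicit
function theorem controls. The interval `[-2, 2]` has both `0` and `1` in its interior. -/
theorem exists_local_flow {f : E → E} (hf : ContDiff ℝ ∞ f) (hc : HasCompactSupport f) (x₀ : E) :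
    ∃ ψ : ℝ × E → ℝ → E, ContDiffAt ℝ ∞ (fun q => ψ q 1) (0, x₀) ∧
      ∀ U ∈ 𝓝 x₀, ∀ᶠ q in 𝓝 ((0 : ℝ), x₀), ψ q 0 = q.2 ∧
        ∀ s ∈ Set.Ioo (-2 : ℝ) 2, ψ q s ∈ U ∧ HasDerivAt (ψ q) (q.1 • f (ψ q s)) s := by
  let fc : C(E, E) := ⟨f, hf.continuous⟩
  let T := Set.Icc (-2 : ℝ) 2
  have hN : ContDiff ℝ ∞ (fun γ : C(T, E) => fc.comp γ) :=
    contDiff_infty.2 fun k => contDiff_superposition k fc hf hc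
  -- The zeros of `G` are the solutions of the integral equation `γ(s) = y + τ ∫₀ˢ f(γ)`.
  let G : (ℝ × E) × C(T, E) → C(T, E) := fun u =>
    u.2 - ContinuousLinearMap.const ℝ T u.1.2 - u.1.1 • primitiveCLM E (fc.comp u.2)
  let u₀ : (ℝ × E) × C(T, E) := ((0, x₀), ContinuousMap.const T x₀)
  have hG : ContDiff ℝ ∞ G := (contDiff_snd.sub ((ContinuousLinearMap.const ℝ T).contDiff.comp
    (contDiff_snd.comp contDiff_fst))).sub ((contDiff_fst.comp contDiff_fst).smul
      ((primitiveCLM E).contDiff.comp (hN.comp contDiff_snd)))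
  have hG0 : G u₀ = 0 := by
    ext t
    simp [G, u₀]
  -- At `τ = 0` the integral term drops out, and the partial derivative in `γ` is the identity.
  have hinv : (fderiv ℝ G u₀ ∘L .inr ℝ (ℝ × E) C(T, E)).IsInvertible := by
    have h1 : HasFDerivAt (fun γ => G (u₀.1, γ)) (fderiv ℝ G u₀ ∘L .inr ℝ (ℝ × E) C(T, E)) u₀.2 :=
      ((hG.differentiable (by simp)) u₀).hasFDerivAt.comp u₀.2 (hasFDerivAt_prodMk_right u₀.1 u₀.2)
    have h2 : (fun γ => G (u₀.1, γ)) = fun γ => γ - ContinuousMap.const T x₀ := by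
      ext γ t
      simp [G, u₀]
    rw [h2] at h1
    rw [h1.unique ((hasFDerivAt_id _).sub_const _)]
    exact ⟨ContinuousLinearEquiv.refl ℝ _, rfl⟩
  have hGu := hG.contDiffAt (x := u₀)
  let Ψ := hGu.implicitFunction (by simp) hinv
  have hΨ : ContDiffAt ℝ ∞ Ψ (0, x₀) := hGu.contDiffAt_implicitFunction (by simp) hinv
  have hΨ0 : Ψ (0, x₀) = ContinuousMap.const T x₀ := hGu.implicitFunction_apply_self (by simp) hinv
  let L : C(T, E) →L[ℝ] E := ContinuousMap.evalCLM ℝ (Set.projIcc (-2) 2 (by norm_num) 1)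
  have heval : ContDiff ℝ ∞ L := L.contDiff
  refine ⟨fun q s => Ψ q (Set.projIcc (-2) 2 (by norm_num) s),
    heval.contDiffAt.comp (0, x₀) hΨ, fun U hU => ?_⟩
  obtain ⟨r, hr, hrU⟩ := Metric.mem_nhds_iff.1 hU
  filter_upwards [hGu.eventually_apply_implicitFunction (by simp) hinv,
    hΨ.continuousAt.eventually_mem (Metric.ball_mem_nhds _ hr)] with q hq1 hq2
  have hq3 : ∀ t : T, Ψ q t = q.2 + q.1 • ∫ τ in (0 : ℝ)..t,
      f (Ψ q (Set.projIcc (-2) 2 (by norm_num) τ)) := by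
    intro t
    have h1 : G (q, Ψ q) t = 0 := by
      rw [hq1.trans hG0]
      rfl
    have h2 : Ψ q t - q.2 - q.1 • ∫ τ in (0 : ℝ)..t,
      f (Ψ q (Set.projIcc (-2) 2 (by norm_num) τ)) = 0 := h1
    rw [sub_sub, sub_eq_zero] at h2
    exact h2
  constructor
  · have h0 : (0 : ℝ) ∈ Set.Icc (-2 : ℝ) 2 := by norm_num
    rw [Set.projIcc_of_mem _ h0, hq3]
    simp
  · intro s hs
    constructor
    -- `Ψ q` is close in the sup norm to the constant curve at `x₀`, so all its values lie in `U` at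
    -- once.
    · refine hrU ?_
      have h1 := (ContinuousMap.dist_apply_le_dist (Set.projIcc (-2) 2 (by norm_num) s)).trans_lt
        (Metric.mem_ball.1 hq2)
      rw [hΨ0] at h1
      exact h1
    · have hcont : Continuous fun τ => f (Ψ q (Set.projIcc (-2) 2 (by norm_num) τ)) :=
        hf.continuous.comp (continuous_extend_Icc (Ψ q))
      have h1 := ((intervalIntegral.integral_hasDerivAt_right (hcont.intervalIntegrable 0 s)
        (hcont.stronglyMeasurableAtFilter _ _) hcont.continuousAt).const_smul q.1).const_add q.2
      refine h1.congr_of_eventuallyEq ?_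
      filter_upwards [isOpen_Ioo.mem_nhds hs] with τ hτ
      rw [hq3, Set.projIcc_of_mem _ (Set.Ioo_subset_Icc_self hτ)]
      rfl

end LocalFlow

theorem exists_compactSupport_eventuallyEq {E F : Type*} [NormedAddCommGroup E] [NormedSpace ℝ E]
    [FiniteDimensional ℝ E] [NormedAddCommGroup F] [NormedSpace ℝ F] {U : Set E} (hU : IsOpen U)
    {g : E → F} (hg : ∀ y ∈ U, ContDiffAt ℝ ∞ g y) {y₀ : E} (hy₀ : y₀ ∈ U) :
    ∃ f : E → F, ContDiff ℝ ∞ f ∧ HasCompactSupport f ∧ f =ᶠ[𝓝 y₀] g := by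
  obtain ⟨r, hr, hrU⟩ := Metric.nhds_basis_closedBall.mem_iff.1 (hU.mem_nhds hy₀)
  let b : ContDiffBump y₀ := ⟨r / 2, r, half_pos hr, half_lt_self hr⟩
  have h0 : ∀ y ∉ Metric.closedBall y₀ r, b y • g y = 0 := fun y hy => by
    rw [b.zero_of_le_dist (not_le.1 hy).le, zero_smul]
  refine ⟨fun y => b y • g y, contDiff_iff_contDiffAt.2 fun y => ?_,
    HasCompactSupport.intro (isCompact_closedBall y₀ r) h0, ?_⟩
  · by_cases hy : y ∈ Metric.closedBall y₀ r
    · exact b.contDiffAt.smul (hg y (hrU hy))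
    · refine (contDiffAt_const (c := 0)).congr_of_eventuallyEq ?_
      filter_upwards [Metric.isClosed_closedBall.isOpen_compl.mem_nhds hy] with z hz using h0 z hz
  · filter_upwards [b.eventuallyEq_one] with y hy
    rw [hy, Pi.one_apply, one_smul]

/-! ### The global flow of a vector field on a compact manifold. -/

section Flow

variable {n : ℕ} {M : Type*} [TopologicalSpace M] [ChartedSpace (EuclideanSpace ℝ (Fin n)) M]
  [IsManifold (𝓡 n) ∞ M]

theorem exists_local_flow_manifold (Y : VField n M) (x₀ : M) :
    ∃ φ : ℝ × M → M, ContMDiffAt (𝓘(ℝ, ℝ).prod (𝓡 n)) (𝓡 n) ∞ φ (0, x₀) ∧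
      ∀ᶠ q in 𝓝 ((0 : ℝ), x₀), ∃ γ : ℝ → M, γ 0 = q.2 ∧ γ 1 = φ q ∧
        IsMIntegralCurveOn (I := 𝓡 n) γ (q.1 • (Y : ∀ x, TangentSpace (𝓡 n) x))
          (Set.Ioo (-2) 2) := by
  let e := extChartAt (𝓡 n) x₀
  have hx₀ : x₀ ∈ e.source := mem_extChartAt_source x₀
  have hto : IsOpen e.target := isOpen_extChartAt_target x₀
  obtain ⟨f, hf, hfc, hfY⟩ := exists_compactSupport_eventuallyEq hto
    (fun y hy => contDiffAt_coordRep (k := ⊤) hy (Y.contMDiff _)) (e.map_source hx₀)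
  obtain ⟨ψ, hψ, hψ'⟩ := exists_local_flow hf hfc (e x₀)
  -- The cut-off field `f` represents `Y` only near the base point; curves confined to this
  -- neighbourhood solve the equation of `Y` itself.
  have hU : e.target ∩ {y | f y = coordRep x₀ Y y} ∈ 𝓝 (e x₀) :=
    Filter.inter_mem (hto.mem_nhds (e.map_source hx₀)) hfY
  have hev := hψ' _ hU
  have h1 : ψ (0, e x₀) 1 ∈ e.target := (hev.self_of_nhds.2 1 (by norm_num)).1.1
  have hq : ContMDiffAt (𝓘(ℝ, ℝ).prod (𝓡 n)) 𝓘(ℝ, ℝ × EuclideanSpace ℝ (Fin n)) ∞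
      (fun q : ℝ × M => (q.1, e q.2)) (0, x₀) :=
    contMDiffAt_fst.prodMk_space (contMDiffAt_extChartAt.comp (0, x₀) contMDiffAt_snd)
  refine ⟨fun q => e.symm (ψ (q.1, e q.2) 1), ?_, ?_⟩
  · exact (contMDiffAt_extChartAt_symm_of_mem h1).comp (0, x₀) (hψ.contMDiffAt.comp (0, x₀) hq)
  · have hs : ∀ᶠ q : ℝ × M in 𝓝 (0, x₀), q.2 ∈ e.source :=
      continuousAt_snd.eventually_mem (extChartAt_source_mem_nhds x₀)
    filter_upwards [hq.continuousAt.eventually hev, hs] with q ⟨hq0, hqs⟩ hqe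
    refine ⟨fun s => e.symm (ψ (q.1, e q.2) s), ?_, rfl, fun s hs => ?_⟩
    · exact (congrArg e.symm hq0).trans (e.left_inv hqe)
    · obtain ⟨⟨hy, hfy⟩, hd⟩ := hqs s hs
      have hm := ((contMDiffAt_extChartAt_symm_of_mem hy).mdifferentiableAt
        (by simp)).hasMFDerivAt.comp s hd.hasFDerivAt.hasMFDerivAt
      have hv : q.1 • Y (e.symm (ψ (q.1, e q.2) s)) =
          mfderiv 𝓘(ℝ, EuclideanSpace ℝ (Fin n)) (𝓡 n) e.symm (ψ (q.1, e q.2) s)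
            (q.1 • f (ψ (q.1, e q.2) s)) := by
        have h2 := coordField_coordComp (e.map_target hy) (Y (e.symm (ψ (q.1, e q.2) s)))
        rw [coordField_symm hy] at h2
        refine Eq.trans ?_ (map_smul (mfderiv 𝓘(ℝ, EuclideanSpace ℝ (Fin n)) (𝓡 n) e.symm
          (ψ (q.1, e q.2) s)) q.1 (f (ψ (q.1, e q.2) s))).symm
        rw [Set.mem_ofPred_eq.mp hfy]
        exact congrArg (q.1 • ·) h2.symm
      refine (hm.congr_mfderiv ?_).hasMFDerivWithinAt
      ext
      exact (congrArg (mfderiv 𝓘(ℝ, EuclideanSpace ℝ (Fin n)) (𝓡 n) e.symm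
        (ψ (q.1, e q.2) s)) (one_smul ℝ _)).trans (hv.symm.trans (one_smul ℝ _).symm)

/-- `Φ` is the flow of the vector field `Y`. -/
structure IsFlow (Y : VField n M) (Φ : ℝ → M → M) : Prop where
  zero (x : M) : Φ 0 x = x
  curve (x : M) : IsMIntegralCurve (I := 𝓡 n) (fun t => Φ t x) Y

/-- Compactness provides one existence time for all initial points, and a uniform time lets integral
curves be continued indefinitely. -/
theorem exists_isFlow [CompactSpace M] [T2Space M] (Y : VField n M) : ∃ Φ, IsFlow Y Φ := by
  have hone : (1 : WithTop ℕ∞) ≤ ∞ := by exact_mod_cast le_top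
  have h1 : ∀ᶠ ε in 𝓝 (0 : ℝ), ∀ x ∈ (Set.univ : Set M), ∃ γ : ℝ → M, γ 0 = x ∧
      IsMIntegralCurveOn (I := 𝓡 n) γ (ε • (Y : ∀ x, TangentSpace (𝓡 n) x)) (Set.Ioo (-2) 2) := by
    refine isCompact_univ.eventually_forall_of_forall_eventually fun x _ => ?_
    obtain ⟨φ, -, hφ⟩ := exists_local_flow_manifold Y x
    filter_upwards [hφ] with q ⟨γ, hγ0, _, hγ⟩ using ⟨γ, hγ0, hγ⟩
  obtain ⟨ε, hε, hε0⟩ := ((h1.filter_mono nhdsWithin_le_nhds).and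
    (self_mem_nhdsWithin (a := (0 : ℝ)) (s := Set.Ioi 0))).exists
  have hε0' : 0 < ε := hε0
  have h2 : ∀ x : M, ∃ γ : ℝ → M, γ 0 = x ∧
      IsMIntegralCurveOn (I := 𝓡 n) γ (Y : ∀ x, TangentSpace (𝓡 n) x) (Set.Ioo (-ε) ε) := by
    intro x
    obtain ⟨γ, hγ0, hγ⟩ := hε x (Set.mem_univ x)
    -- A curve of `ε Y` on `(-2, 2)`, slowed down by `ε`, is a curve of `Y` on `(-2ε, 2ε)`.
    refine ⟨γ ∘ (· * ε⁻¹), by simpa using hγ0, ?_⟩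
    have h3 := hγ.comp_mul ε⁻¹
    rw [smul_smul, inv_mul_cancel₀ hε0'.ne', one_smul] at h3
    refine h3.mono fun t ht => ?_
    have h4 : |t * ε⁻¹| < 1 := by
      rw [abs_mul, abs_of_pos (inv_pos.2 hε0'), ← div_eq_mul_inv, div_lt_one hε0']
      exact abs_lt.2 ht
    have h5 := abs_lt.1 h4
    exact ⟨by linarith, by linarith⟩
  choose Φ hΦ using exists_isMIntegralCurve_of_isMIntegralCurveOn (Y.contMDiff.of_le hone) hε0' h2
  exact ⟨fun t x => Φ x t, fun x => (hΦ x).1, fun x => (hΦ x).2⟩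

namespace IsFlow

variable [T2Space M] {Y : VField n M} {Φ : ℝ → M → M}

theorem add (h : IsFlow Y Φ) (s t : ℝ) (x : M) : Φ (s + t) x = Φ s (Φ t x) := by
  have hone : (1 : WithTop ℕ∞) ≤ ∞ := by exact_mod_cast le_top
  refine congrFun (isMIntegralCurve_Ioo_eq_of_contMDiff_boundaryless (t₀ := 0)
    (Y.contMDiff.of_le hone) ((h.curve x).comp_add t) (h.curve (Φ t x)) ?_) s
  simp [h.zero]

/-- `IsFlow` prescribes only the individual integral curves. Uniqueness identifies them with the
smooth local solution: `s ↦ Φ (q.1 * s)` is a curve of `q.1 • Y`, compared at `s = 1`. -/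
theorem contMDiffAt_zero (h : IsFlow Y Φ) (x : M) :
    ContMDiffAt (𝓘(ℝ, ℝ).prod (𝓡 n)) (𝓡 n) ∞ (fun q : ℝ × M => Φ q.1 q.2) (0, x) := by
  have hone : (1 : WithTop ℕ∞) ≤ ∞ := by exact_mod_cast le_top
  obtain ⟨φ, hφ, hφ'⟩ := exists_local_flow_manifold Y x
  refine hφ.congr_of_eventuallyEq ?_
  filter_upwards [hφ'] with q ⟨γ, hγ0, hγ1, hγ⟩
  have h1 := ((h.curve q.2).comp_mul q.1).isMIntegralCurveOn (Set.Ioo (-2) 2)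
  have h2 := isMIntegralCurveOn_Ioo_eqOn_of_contMDiff_boundaryless (t₀ := 0) (by norm_num)
    ((q.1 • Y).contMDiff.of_le hone) h1 hγ (by simp [hγ0, h.zero])
    (show (1 : ℝ) ∈ Set.Ioo (-2) 2 by norm_num)
  simpa [hγ1] using h2

/-- The order is finite because being `C^k` at a point is then an open condition, which compactness
makes uniform in the initial point. -/
theorem eventually_contMDiff [CompactSpace M] (h : IsFlow Y Φ) (k : ℕ) :
    ∀ᶠ t in 𝓝 (0 : ℝ), ContMDiff (𝓡 n) (𝓡 n) k (Φ t) := by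
  have hk : (k : WithTop ℕ∞) ≤ ∞ := by exact_mod_cast le_top
  have : IsManifold (𝓡 n) k M := .of_le hk
  have h1 : ∀ᶠ t in 𝓝 (0 : ℝ), ∀ x ∈ (Set.univ : Set M), ContMDiffAt (𝓡 n) (𝓡 n) k (Φ t) x := by
    refine isCompact_univ.eventually_forall_of_forall_eventually fun x _ => ?_
    filter_upwards [(contMDiffAt_iff_contMDiffAt_nhds (by simp)).1 ((h.contMDiffAt_zero x).of_le hk)] with q hq
    exact ContMDiffAt.comp (g := fun q : ℝ × M => Φ q.1 q.2) q.2 (f := fun x => (q.1, x)) hq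
      (contMDiffAt_const.prodMk contMDiffAt_id)
  filter_upwards [h1] with t ht x using ht x (Set.mem_univ x)

/-- For each order `k`, the map `Φ t` is the `N`-fold iterate of `Φ (t / N)`, which is `C^k` for
suitable large `N`. -/
theorem contMDiff [CompactSpace M] (h : IsFlow Y Φ) (t : ℝ) :
    ContMDiff (𝓡 n) (𝓡 n) ∞ (Φ t) := by
  refine contMDiff_infty.2 fun k => ?_
  have hlim : Filter.Tendsto (fun N : ℕ => t / N) Filter.atTop (𝓝 0) :=
    tendsto_const_div_atTop_nhds_zero_nat t
  obtain ⟨N, hN, hN0⟩ := ((hlim.eventually (h.eventually_contMDiff k)).and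
    (Filter.eventually_gt_atTop 0)).exists
  have h1 : ∀ m : ℕ, ContMDiff (𝓡 n) (𝓡 n) k (Φ (m * (t / N))) := by
    intro m
    induction m with
    | zero =>
      have : Φ (((0 : ℕ) : ℝ) * (t / N)) = id := funext fun x => by simp [h.zero]
      rw [this]
      exact contMDiff_id
    | succ m ih =>
      have : Φ (((m + 1 : ℕ) : ℝ) * (t / N)) = Φ (t / N) ∘ Φ (m * (t / N)) := funext fun x => by
        rw [Function.comp_apply, ← h.add]
        congr 1
        push_cast
        ring
      rw [this]
      exact hN.comp ih
  have h2 := h1 N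
  rwa [mul_div_cancel₀ _ (by exact_mod_cast hN0.ne')] at h2

/-- The diffeomorphisms of a flow. -/
def diffeomorph [CompactSpace M] (h : IsFlow Y Φ) (t : ℝ) : Diffeomorph (𝓡 n) (𝓡 n) M M ∞ where
  toFun := Φ t
  invFun := Φ (-t)
  left_inv x := by rw [← h.add, neg_add_cancel, h.zero]
  right_inv x := by rw [← h.add, add_neg_cancel, h.zero]
  contMDiff_toFun := h.contMDiff t
  contMDiff_invFun := h.contMDiff (-t)

end IsFlow

end Flow

/-- Symmetry of the second derivative: the time and space derivatives of `φ` commute. It gives the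
linearized flow at time zero. -/
theorem hasDerivAt_fderiv_of_hasDerivAt {E F : Type*} [NormedAddCommGroup E] [NormedSpace ℝ E]
    [NormedAddCommGroup F] [NormedSpace ℝ F] {φ : ℝ × E → F} {f : E → F} {y₀ : E}
    (hφ : ContDiffAt ℝ 2 φ (0, y₀)) (hf : ∀ᶠ y in 𝓝 y₀, HasDerivAt (fun s => φ (s, y)) (f y) 0)
    (u : E) : HasDerivAt (fun s => fderiv ℝ φ (s, y₀) (0, u)) (fderiv ℝ f y₀ u) 0 := by
  have h1 : DifferentiableAt ℝ (fderiv ℝ φ) (0, y₀) :=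
    (hφ.fderiv_right (m := 1) (by norm_num)).differentiableAt (by simp)
  have h2 : HasDerivAt (fun s => fderiv ℝ φ (s, y₀) (0, u))
      (fderiv ℝ (fderiv ℝ φ) (0, y₀) (1, 0) (0, u)) 0 := by
    have h3 : HasDerivAt (fun s : ℝ => (s, y₀)) ((1 : ℝ), (0 : E)) 0 :=
      (hasDerivAt_id _).prodMk (hasDerivAt_const _ _)
    have h4 := (HasFDerivAt.comp_hasDerivAt (x := (0 : ℝ)) (f := fun s : ℝ => (s, y₀))
      (l := fderiv ℝ φ) (hl := h1.hasFDerivAt) (hf := h3))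
    have h5 := h4.clm_apply (hasDerivAt_const (0 : ℝ) ((0 : ℝ), u))
    simpa using h5
  have h6 : HasFDerivAt (fun y => fderiv ℝ φ (0, y) (1, 0))
      (((fderiv ℝ (fderiv ℝ φ) (0, y₀)).comp (.inr ℝ ℝ E)).flip (1, 0)) y₀ := by
    have h7 := h1.hasFDerivAt.comp y₀ (hasFDerivAt_prodMk_right (0 : ℝ) y₀)
    have h8 := h7.clm_apply (hasFDerivAt_const ((1 : ℝ), (0 : E)) y₀)
    simpa using h8
  have h9 : (fun y => fderiv ℝ φ (0, y) (1, 0)) =ᶠ[𝓝 y₀] f := by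
    have h10 : ∀ᶠ q in 𝓝 ((0 : ℝ), y₀), DifferentiableAt ℝ φ q := by
      filter_upwards [hφ.eventually (by simp)] with q hq using hq.differentiableAt (by simp)
    have h11 : Filter.Tendsto (fun y : E => ((0 : ℝ), y)) (𝓝 y₀) (𝓝 (0, y₀)) :=
      (Continuous.prodMk_right 0).tendsto y₀
    filter_upwards [h11.eventually h10, hf] with y hy hfy
    have h3 : HasDerivAt (fun s : ℝ => (s, y)) ((1 : ℝ), (0 : E)) 0 :=
      (hasDerivAt_id _).prodMk (hasDerivAt_const _ _)
    exact (hy.hasFDerivAt.comp_hasDerivAt (0 : ℝ) h3).unique hfy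
  have h12 := congrArg (fun A => A u) (h6.congr_of_eventuallyEq h9.symm).fderiv
  have hsymm : IsSymmSndFDerivAt ℝ φ (0, y₀) := hφ.isSymmSndFDerivAt (by simp)
  convert h2 using 1
  rw [hsymm.eq]
  exact h12

/-! ### Derivative of the metric along a curve of tangent vectors. -/

section MetricDerivative

variable {n : ℕ} {M : Type*} [TopologicalSpace M] [ChartedSpace (EuclideanSpace ℝ (Fin n)) M]
  [IsManifold (𝓡 n) ∞ M] {c p : M}

theorem coordField_eq_sum (α : EuclideanSpace ℝ (Fin n)) (q : M) :
    coordField c α q = ∑ i, α i • coordField c (EuclideanSpace.single i 1) q := by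
  have h : α = ∑ i, α i • EuclideanSpace.single i (1 : ℝ) := by
    ext j
    simp [Finset.sum_apply, Pi.single_apply]
  conv_lhs => rw [h]
  simp only [coordField, map_sum, map_smul]

variable [RiemannianBundle (fun x : M => TangentSpace (𝓡 n) x)]
  [IsContMDiffRiemannianBundle (𝓡 n) ∞ (EuclideanSpace ℝ (Fin n))
    (fun x : M => TangentSpace (𝓡 n) x)]

theorem differentiableAt_inner_coordField (hp : p ∈ (extChartAt (𝓡 n) c).source)
    (α : EuclideanSpace ℝ (Fin n)) :
    DifferentiableAt ℝ (fun q : EuclideanSpace ℝ (Fin n) × EuclideanSpace ℝ (Fin n) =>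
      (inner ℝ (coordField c q.1 ((extChartAt (𝓡 n) c).symm q.2))
        (coordField c q.1 ((extChartAt (𝓡 n) c).symm q.2)) : ℝ)) (α, extChartAt (𝓡 n) c p) := by
  have h : ∀ q : EuclideanSpace ℝ (Fin n) × EuclideanSpace ℝ (Fin n),
      (inner ℝ (coordField c q.1 ((extChartAt (𝓡 n) c).symm q.2))
        (coordField c q.1 ((extChartAt (𝓡 n) c).symm q.2)) : ℝ) = ∑ i, ∑ j, q.1 i * (q.1 j *
      inner ℝ (coordField c (EuclideanSpace.single i 1) ((extChartAt (𝓡 n) c).symm q.2))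
        (coordField c (EuclideanSpace.single j 1) ((extChartAt (𝓡 n) c).symm q.2))) := by
    intro q
    rw [coordField_eq_sum q.1, sum_inner]
    simp only [inner_sum, real_inner_smul_left, real_inner_smul_right]
    exact Finset.sum_congr rfl fun i _ => Finset.sum_congr rfl fun j _ => by ring
  simp only [h]
  refine DifferentiableAt.fun_sum fun i _ => DifferentiableAt.fun_sum fun j _ => ?_
  have hG := (contDiffAt_inner_comp_symm hp (contMDiffAt_coordField hp (EuclideanSpace.single i 1))
    (contMDiffAt_coordField hp (EuclideanSpace.single j 1))).differentiableAt (by simp)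
  have hsnd : DifferentiableAt ℝ (fun q : EuclideanSpace ℝ (Fin n) × EuclideanSpace ℝ (Fin n) => q.2)
      (α, extChartAt (𝓡 n) c p) := differentiableAt_snd
  have hG' := DifferentiableAt.comp (α, extChartAt (𝓡 n) c p) hG hsnd
  have hc : ∀ i : Fin n, DifferentiableAt ℝ
      (fun q : EuclideanSpace ℝ (Fin n) × EuclideanSpace ℝ (Fin n) => q.1 i)
      (α, extChartAt (𝓡 n) c p) := fun i =>
    (EuclideanSpace.proj (𝕜 := ℝ) i).differentiableAt.comp _ differentiableAt_fst
  exact (hc i).mul ((hc j).mul hG')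

/-- The squared length depends on the components `a` and the foot point `z` separately; the two
terms are its partial derivatives. -/
theorem hasDerivAt_inner_coordField (hp : p ∈ (extChartAt (𝓡 n) c).source)
    {a z : ℝ → EuclideanSpace ℝ (Fin n)} {a' z' : EuclideanSpace ℝ (Fin n)}
    (ha : HasDerivAt a a' 0) (hz : HasDerivAt z z' 0) (hz0 : z 0 = extChartAt (𝓡 n) c p) :
    HasDerivAt (fun s => (inner ℝ (coordField c (a s) ((extChartAt (𝓡 n) c).symm (z s)))
        (coordField c (a s) ((extChartAt (𝓡 n) c).symm (z s))) : ℝ))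
      (2 * inner ℝ (coordField c a' p) (coordField c (a 0) p) +
        mvfderiv (𝓡 n) (fun q => (inner ℝ (coordField c (a 0) q) (coordField c (a 0) q) : ℝ)) p
          (coordField c z' p)) 0 := by
  have hQ := (differentiableAt_inner_coordField hp (a 0)).hasFDerivAt
  set Q := fun q : EuclideanSpace ℝ (Fin n) × EuclideanSpace ℝ (Fin n) =>
      (inner ℝ (coordField c q.1 ((extChartAt (𝓡 n) c).symm q.2))
        (coordField c q.1 ((extChartAt (𝓡 n) c).symm q.2)) : ℝ) with hQdef
  have haz : HasDerivAt (fun s => (a s, z s)) (a', z') 0 := ha.prodMk hz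
  have h0 := HasFDerivAt.comp_hasDerivAt_of_eq (0 : ℝ) hQ haz (by rw [hz0])
  have h1 : fderiv ℝ Q (a 0, extChartAt (𝓡 n) c p) (0, z') =
      mvfderiv (𝓡 n) (fun q => (inner ℝ (coordField c (a 0) q) (coordField c (a 0) q) : ℝ)) p
          (coordField c z' p) := by
    rw [mvfderiv_coordField hp (mdifferentiableAt_inner (mdifferentiableAt_coordField hp _)
      (mdifferentiableAt_coordField hp _))]
    exact congrArg (fun A => A z')
      (hQ.comp (extChartAt (𝓡 n) c p) (hasFDerivAt_prodMk_right (a 0) _)).fderiv.symm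
  have h2 : fderiv ℝ Q (a 0, extChartAt (𝓡 n) c p) (a', 0) =
      2 * inner ℝ (coordField c a' p) (coordField c (a 0) p) := by
    have h3 : HasFDerivAt (fun α => Q (α, extChartAt (𝓡 n) c p))
        ((fderiv ℝ Q (a 0, extChartAt (𝓡 n) c p)).comp (.inl ℝ _ _)) (a 0) :=
      HasFDerivAt.comp (g := Q) (f := fun α => (α, extChartAt (𝓡 n) c p)) (a 0) hQ (hasFDerivAt_prodMk_left (𝕜 := ℝ) (a 0) (extChartAt (𝓡 n) c p))
    let L : EuclideanSpace ℝ (Fin n) →L[ℝ] TangentSpace (𝓡 n) p :=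
      LinearMap.toContinuousLinearMap
        ((trivializationAt (EuclideanSpace ℝ (Fin n)) (TangentSpace (𝓡 n) : M → Type _) c).symmL ℝ
          p).toLinearMap
    have hL : ∀ α, coordField c α p = L α := fun α => rfl
    have h4 : (fun α => Q (α, extChartAt (𝓡 n) c p)) = fun α => (inner ℝ (L α) (L α) : ℝ) := by
      funext α
      simp only [hQdef, ← hL]
      exact congrArg (fun q => (inner ℝ (coordField c α q) (coordField c α q) : ℝ))
        ((extChartAt (𝓡 n) c).left_inv hp)
    have h5 := (L.hasFDerivAt (x := a 0)).inner ℝ (L.hasFDerivAt (x := a 0))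
    rw [h4] at h3
    have h6 := congrArg (fun A => A a') (h3.unique h5)
    refine Eq.trans (by simp) (h6.trans ?_)
    simp [hL, real_inner_comm (L (a 0)) (L a'), two_mul]
  rw [← h1, ← h2, ← map_add, Prod.mk_add_mk, add_zero, zero_add]
  exact h0

end MetricDerivative

/-! ### First variation of the metric under a flow, and Killing fields. -/

section FlowDerivative

variable {n : ℕ} {M : Type*} [TopologicalSpace M] [ChartedSpace (EuclideanSpace ℝ (Fin n)) M]
  [IsManifold (𝓡 n) ∞ M] {Y : VField n M} {Φ : ℝ → M → M}

theorem IsFlow.hasDerivAt_extChartAt (h : IsFlow Y Φ) {c x : M} {s : ℝ}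
    (hs : Φ s x ∈ (extChartAt (𝓡 n) c).source) :
    HasDerivAt (fun s => extChartAt (𝓡 n) c (Φ s x)) (coordComp c (Φ s x) (Y (Φ s x))) s := by
  have h1 := mdifferentiableAt_extChartAt (I := 𝓡 n) (x := c) (y := Φ s x) (by simpa using hs)
  have h2 := HasMFDerivAt.comp s h1.hasMFDerivAt (h.curve x s)
  rw [← coordComp_eq_mfderiv hs] at h2
  have h3 : HasFDerivAt (fun s => extChartAt (𝓡 n) c (Φ s x)) ((coordComp c (Φ s x)).comp
      ((1 : ℝ →L[ℝ] ℝ).smulRight (Y (Φ s x))) : ℝ →L[ℝ] EuclideanSpace ℝ (Fin n)) s :=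
    hasMFDerivAt_iff_hasFDerivAt.1 h2
  have h4 : coordComp c (Φ s x) ((1 : ℝ) • Y (Φ s x)) = coordComp c (Φ s x) (Y (Φ s x)) := by
    rw [one_smul]
  rw [← h4]
  exact h3.hasDerivAt

variable [T2Space M]

theorem IsFlow.contDiffAt_coord (h : IsFlow Y Φ) (x : M) :
    ContDiffAt ℝ ∞ (fun q : ℝ × EuclideanSpace ℝ (Fin n) =>
      extChartAt (𝓡 n) x (Φ q.1 ((extChartAt (𝓡 n) x).symm q.2))) (0, extChartAt (𝓡 n) x x) := by
  rw [← contMDiffAt_iff_contDiffAt]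
  have hy := (extChartAt (𝓡 n) x).map_source (mem_extChartAt_source (I := 𝓡 n) x)
  have h1 : ContMDiffAt 𝓘(ℝ, ℝ × EuclideanSpace ℝ (Fin n)) (𝓘(ℝ, ℝ).prod (𝓡 n)) ∞
      (fun q : ℝ × EuclideanSpace ℝ (Fin n) => (q.1, (extChartAt (𝓡 n) x).symm q.2))
      (0, extChartAt (𝓡 n) x x) :=
    contDiff_fst.contMDiff.contMDiffAt.prodMk ((contMDiffAt_extChartAt_symm_of_mem hy).comp
      ((0 : ℝ), extChartAt (𝓡 n) x x) contDiff_snd.contMDiff.contMDiffAt)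
  have h2 := ContMDiffAt.comp_of_eq (h.contMDiffAt_zero x) h1 (by simp)
  refine ContMDiffAt.comp_of_eq (contMDiffAt_extChartAt (I := 𝓡 n) (x := x)) h2 ?_
  simp [h.zero]

variable [RiemannianBundle (fun x : M => TangentSpace (𝓡 n) x)]
  [IsContMDiffRiemannianBundle (𝓡 n) ∞ (EuclideanSpace ℝ (Fin n))
    (fun x : M => TangentSpace (𝓡 n) x)] [CompactSpace M]

/-- This is `(L_Y g)(v, v)`. With `V` the coordinate field extending `v`, the components of `dΦ_s v`
have derivative `[V, Y]` at zero, so the result is `2 g([V, Y], v) + Y g(V, V)`. The terms `∇_Y V`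
cancel and leave `2 g(∇_v Y, v)`. -/
theorem IsFlow.hasDerivAt_metric_zero (h : IsFlow Y Φ) (x : M) (v : TangentSpace (𝓡 n) x) :
    HasDerivAt (fun s => metricTensor (𝓡 n) (Φ s x) (mfderiv (𝓡 n) (𝓡 n) (Φ s) x v)
      (mfderiv (𝓡 n) (𝓡 n) (Φ s) x v)) (2 * inner ℝ (nabla (𝓡 n) Y x v) v) 0 := by
  let e := extChartAt (𝓡 n) x
  have hx : x ∈ e.source := mem_extChartAt_source x
  let φ : ℝ × EuclideanSpace ℝ (Fin n) → EuclideanSpace ℝ (Fin n) := fun q =>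
    e (Φ q.1 (e.symm q.2))
  have hφ : ContDiffAt ℝ ∞ φ (0, e x) := h.contDiffAt_coord x
  have hφ2 : ContDiffAt ℝ 2 φ (0, e x) := hφ.of_le ENat.LEInfty.out
  have htar : ∀ᶠ y in 𝓝 (e x), y ∈ e.target :=
    (isOpen_extChartAt_target x).mem_nhds (e.map_source hx)
  let u : EuclideanSpace ℝ (Fin n) := coordComp x x v
  have hu : coordField x u x = v := coordField_coordComp hx v
  have hY0 : ∀ᶠ y in 𝓝 (e x), HasDerivAt (fun s => φ (s, y)) (coordRep x Y y) 0 := by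
    filter_upwards [htar] with y hy
    have h1 : Φ 0 (e.symm y) ∈ e.source := by
      rw [h.zero]
      exact e.map_target hy
    have h2 := h.hasDerivAt_extChartAt h1
    rw [h.zero] at h2
    exact h2
  -- For small `s`, while `Φ s x` stays in the chart, these are the components of `dΦ_s v`.
  let a : ℝ → EuclideanSpace ℝ (Fin n) := fun s => fderiv ℝ φ (s, e x) (0, u)
  have ha := hasDerivAt_fderiv_of_hasDerivAt hφ2 hY0 u
  have hz : HasDerivAt (fun s => e (Φ s x)) (coordComp x x (Y x)) 0 := by
    have h1 : Φ 0 x ∈ e.source := by rwa [h.zero]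
    have h2 := h.hasDerivAt_extChartAt h1
    rw [h.zero] at h2
    exact h2
  have hφs : ∀ᶠ s in 𝓝 (0 : ℝ), DifferentiableAt ℝ φ (s, e x) := by
    have h1 : ∀ᶠ q in 𝓝 ((0 : ℝ), e x), DifferentiableAt ℝ φ q := by
      filter_upwards [hφ2.eventually (by simp)] with q hq using hq.differentiableAt (by simp)
    exact ((Continuous.prodMk_left (e x)).tendsto (0 : ℝ)).eventually h1
  have ha0 : a 0 = u := by
    have h1 := hφs.self_of_nhds.hasFDerivAt.comp (e x) (hasFDerivAt_prodMk_right (0 : ℝ) (e x))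
    have h2 : φ ∘ (fun y => ((0 : ℝ), y)) =ᶠ[𝓝 (e x)] id := by
      filter_upwards [htar] with y hy
      simp only [φ, Function.comp_apply, h.zero, e.right_inv hy, id]
    exact congrArg (fun A => A u) (h1.unique ((hasFDerivAt_id _).congr_of_eventuallyEq h2))
  have hsrc : ∀ᶠ s in 𝓝 (0 : ℝ), Φ s x ∈ e.source := by
    have h1 : ContinuousAt (fun s => Φ s x) 0 := (h.curve x).continuous.continuousAt
    refine h1.eventually_mem ?_
    rw [h.zero]
    exact extChartAt_source_mem_nhds x
  have key : ∀ᶠ s in 𝓝 (0 : ℝ),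
      mfderiv (𝓡 n) (𝓡 n) (Φ s) x v = coordField x (a s) (Φ s x) := by
    filter_upwards [hsrc, hφs] with s hs hds
    have hΦ : MDifferentiableAt (𝓡 n) (𝓡 n) (Φ s) x :=
      (h.contMDiff s x).mdifferentiableAt (by simp)
    have he := mdifferentiableAt_extChartAt (I := 𝓡 n) (x := x) (y := Φ s x)
      (by rw [← extChartAt_source (𝓡 n)]; exact hs)
    have h1 := mvfderiv_apply_eq (h := e ∘ Φ s) hx (he.comp x hΦ) v
    have h2 : mvfderiv (𝓡 n) (e ∘ Φ s) x v =
        coordComp x (Φ s x) (mfderiv (𝓡 n) (𝓡 n) (Φ s) x v) := by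
      rw [coordComp_eq_mfderiv hs]
      exact congrArg (fun A => A v) (mfderiv_comp x he hΦ)
    have h3 : fderiv ℝ ((e ∘ Φ s) ∘ e.symm) (e x) u = a s :=
      congrArg (fun A => A u)
        (hds.hasFDerivAt.comp (e x) (hasFDerivAt_prodMk_right s (e x))).fderiv
    rw [← coordField_coordComp hs (mfderiv (𝓡 n) (𝓡 n) (Φ s) x v), ← h2, h1]
    exact congrArg (fun w => coordField x w (Φ s x)) h3
  have hD := hasDerivAt_inner_coordField hx ha hz (by rw [h.zero])
  have hYx : VDiffAt Y x := Y.mdifferentiableAt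
  have hV : VDiffAt (coordField x u) x := mdifferentiableAt_coordField hx u
  change HasDerivAt _ (2 * inner ℝ (coordField x _ x) (coordField x (a 0) x) +
    mvfderiv (𝓡 n) (fun q => (inner ℝ (coordField x (a 0) q) (coordField x (a 0) q) : ℝ)) x
      (coordField x (coordComp x x (Y x)) x)) 0 at hD
  rw [ha0, coordField_coordComp hx (Y x), mvfderiv_inner hV hV, hu, ← mlieBracket_coordField hx hYx,
    mlieBracket_eq_nabla hV hYx, hu, inner_sub_left,
    real_inner_comm (nabla (𝓡 n) (coordField x u) x (Y x)) v] at hD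
  have hval : 2 * ((inner ℝ (nabla (𝓡 n) Y x v) v : ℝ) -
      inner ℝ (nabla (𝓡 n) (coordField x u) x (Y x)) v) +
      (inner ℝ (nabla (𝓡 n) (coordField x u) x (Y x)) v +
        inner ℝ (nabla (𝓡 n) (coordField x u) x (Y x)) v) =
      2 * inner ℝ (nabla (𝓡 n) Y x v) v := by ring
  rw [hval] at hD
  refine hD.congr_of_eventuallyEq ?_
  filter_upwards [hsrc, key] with s hs hks
  rw [hks]
  exact congrArg (fun q => (inner ℝ (coordField x (a s) q) (coordField x (a s) q) : ℝ))
    (e.left_inv hs).symm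

/-- The group law `Φ s = Φ (s - t) ∘ Φ t` moves time `t` to time zero, at the point `Φ t x` and the
vector `dΦ_t v`. -/
theorem IsFlow.hasDerivAt_metric (h : IsFlow Y Φ) (x : M) (v : TangentSpace (𝓡 n) x) (t : ℝ) :
    HasDerivAt (fun s => metricTensor (𝓡 n) (Φ s x) (mfderiv (𝓡 n) (𝓡 n) (Φ s) x v)
      (mfderiv (𝓡 n) (𝓡 n) (Φ s) x v))
      (2 * inner ℝ (nabla (𝓡 n) Y (Φ t x) (mfderiv (𝓡 n) (𝓡 n) (Φ t) x v))
        (mfderiv (𝓡 n) (𝓡 n) (Φ t) x v)) t := by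
  have h1 := h.hasDerivAt_metric_zero (Φ t x) (mfderiv (𝓡 n) (𝓡 n) (Φ t) x v)
  rw [← sub_self t] at h1
  have h2 := h1.comp_sub_const t t
  refine h2.congr_of_eventuallyEq (.of_forall fun s => ?_)
  have hcomp : Φ s = Φ (s - t) ∘ Φ t := funext fun y => by
    rw [Function.comp_apply, ← h.add, sub_add_cancel]
  have hd : ∀ r y, MDifferentiableAt (𝓡 n) (𝓡 n) (Φ r) y := fun r y =>
    (h.contMDiff r y).mdifferentiableAt (by simp)
  change metricTensor (𝓡 n) (Φ s x) (mfderiv (𝓡 n) (𝓡 n) (Φ s) x v)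
      (mfderiv (𝓡 n) (𝓡 n) (Φ s) x v) = _
  rw [hcomp, mfderiv_comp x (hd (s - t) (Φ t x)) (hd t x)]
  rfl

/-- Squared lengths are constant along the flow exactly when their derivative vanishes. Only the
diagonal values `g(dΦ v, dΦ v)` are followed; polarization recovers the full metric. -/
theorem isKilling_iff (Y : VField n M) : IsKilling (𝓡 n) Y ↔
    ∀ x : M, nablaFormSym (𝓡 n) (flat (𝓡 n) Y) x = 0 := by
  have hiff : ∀ x : M, nablaFormSym (𝓡 n) (flat (𝓡 n) Y) x = 0 ↔
      ∀ v : TangentSpace (𝓡 n) x, inner ℝ (nabla (𝓡 n) Y x v) v = 0 := fun x =>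
    nablaFormSym_flat_eq_zero_iff Y.mdifferentiableAt
  simp only [hiff]
  constructor
  · rintro ⟨Φ, h0, hc, hi⟩ x v
    have h : IsFlow Y Φ := ⟨h0, hc⟩
    have h1 := h.hasDerivAt_metric_zero x v
    simp only [fun s => (hi s).2 x v v] at h1
    have h2 := h1.unique (hasDerivAt_const (0 : ℝ) _)
    linarith
  · intro hY
    obtain ⟨Φ, h⟩ := exists_isFlow Y
    refine ⟨Φ, h.zero, h.curve, fun t => ⟨⟨h.diffeomorph t, rfl⟩, fun x => ?_⟩⟩
    have hsq : ∀ v : TangentSpace (𝓡 n) x,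
        metricTensor (𝓡 n) (Φ t x) (mfderiv (𝓡 n) (𝓡 n) (Φ t) x v)
          (mfderiv (𝓡 n) (𝓡 n) (Φ t) x v) = metricTensor (𝓡 n) x v v := by
      intro v
      have h1 := fun s => h.hasDerivAt_metric x v s
      simp only [hY, mul_zero] at h1
      have h2 := is_const_of_deriv_eq_zero (fun s => (h1 s).differentiableAt)
        (fun s => (h1 s).deriv) t 0
      refine h2.trans ?_
      have hid : Φ 0 = id := funext h.zero
      rw [hid, mfderiv_id]
      rfl
    intro v w
    have h1 := hsq (v + w)
    have h2 := hsq v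
    have h3 := hsq w
    rw [map_add] at h1
    simp only [metricTensor_apply] at h1 h2 h3 ⊢
    rw [real_inner_add_add_self, real_inner_add_add_self] at h1
    linarith

end FlowDerivative

end RiemGeom

end

theorem mainTheorem10 (n : ℕ) {M : Type*} [TopologicalSpace M]
    [ChartedSpace (EuclideanSpace ℝ (Fin n)) M] [IsManifold (𝓡 n) ∞ M]
    [CompactSpace M] [T2Space M]
    [RiemannianBundle (fun x : M => TangentSpace (𝓡 n) x)]
    [IsContMDiffRiemannianBundle (𝓡 n) ∞ (EuclideanSpace ℝ (Fin n))
      (fun x : M => TangentSpace (𝓡 n) x)]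
    (o : RiemGeom.ManifoldOrientation n M) :
    (∀ (𝔤 : LieSubalgebra ℝ (RiemGeom.VField n M)) (adT : 𝔤 → 𝔤 →ₗ[ℝ] 𝔤),
      (∀ X : 𝔤, RiemGeom.IsAdjointOfAd o 𝔤 X (adT X)) →
      ∀ X Y : 𝔤,
        2 * RiemGeom.integralVol o
            (fun x => RiemGeom.metricTensor (𝓡 n) x ((adT X X).1 x) (Y.1 x)) =
          RiemGeom.integralVol o
            (fun x => RiemGeom.symDivTensor o Y.1 x (X.1 x) (X.1 x))) ∧
    (∀ (Y : RiemGeom.VField n M) (x : M),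
      RiemGeom.metricTrace (RiemGeom.symDivTensor o Y x) = (n + 2) * RiemGeom.divergence o Y x) ∧
    (∀ Y : RiemGeom.VField n M,
      ((∀ x : M, RiemGeom.symDivTensor o Y x = 0) ↔
        ∀ x : M, RiemGeom.nablaFormSym (𝓡 n) (RiemGeom.flat (𝓡 n) Y) x = 0) ∧
      ((∀ x : M, RiemGeom.symDivTensor o Y x = 0) ↔ RiemGeom.IsKilling (𝓡 n) Y)) := by
  refine ⟨fun 𝔤 adT h X Y => RiemGeom.integralVol_adjoint_eq o 𝔤 X Y (adT X) (h X),
    fun Y x => RiemGeom.metricTrace_symDivTensor o Y.mdifferentiableAt, fun Y => ?_⟩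
  have h1 : (∀ x : M, RiemGeom.symDivTensor o Y x = 0) ↔
      ∀ x : M, RiemGeom.nablaFormSym (𝓡 n) (RiemGeom.flat (𝓡 n) Y) x = 0 :=
    forall_congr' fun x => RiemGeom.symDivTensor_eq_zero_iff o Y.mdifferentiableAt
  exact ⟨h1, h1.trans (RiemGeom.isKilling_iff Y).symm⟩
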